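/- Let $n\ge 0$ and $N>1$ be integers, let $S=\mathbb{C}[x_0,\dots,x_n]$ with its standard grading $S=\bigoplus_k S_k$, and let $f\in S_N$ be a nonzero homogeneous polynomial of degree $N$ with partial derivatives $f_{x_0},\dots,f_{x_n}$. Let $$AR(f)=\Big\{(a_0,\dots,a_n)\in S^{n+1} : \sum_{j=0}^n a_j f_{x_j}=0\Big\}$$ be the module of Jacobian syzygies of $f$, let $KR(f)\subset AR(f)$ be the $S$-submodule generated by the Koszul relations $f_{x_j}e_i-f_{x_i}e_j$, $0\le i,j\le n$ (where $e_0,\dots,e_n$ is the standard basis of $S^{n+1}$), and let $ER(f)=AR(f)/KR(f)$ be the module of essential Jacobian syzygies. It is graded: $ER(f)_m$ is the image of the space of syzygies with all $a_j\in S_m$. For a holomorphic function germ $g$ in the ring $\mathcal{O}_n$ of holomorphic germs at the origin of $\mathbb{C}^n$, with maximal ideal $\mathfrak{m}_n$ and with Jacobian ideal $J_g\subset\mathcal{O}_n$ generated by the first partial derivatives of $g$, put $$a(g)=\min\{a\in\mathbb{N} : \mathfrak{m}_n^a\subset J_g+(g)\},$$ which is well defined when $g=0$ has an isolated singularity at the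 origin. Assume that the hypersurface $V: f=0$ in $\mathbb{P}^n=\mathbb{P}^n(\mathbb{C})$ has only isolated singularities, i.e. its singular set $V_{sing}=\{p : f(p)=f_{x_0}(p)=\dots=f_{x_n}(p)=0\}$ is finite, and for every $p\in V_{sing}$ let $g_p=0$, $g_p\in\mathcal{O}_n$, be a local analytic equation of $V$ at $p$, that is, $g_p$ is, up to a unit of $\mathcal{O}_n$, the expression of $f$ in some local holomorphic coordinates of $\mathbb{P}^n$ centred at $p$. Then $$ER(f)_m=0\quad\text{for all integers } 0\le m\le n(N-2)-\sum_{p\in V_{sing}}a(g_p).$$ -/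

import Mathlib

open scoped LinearAlgebra.Projectivization Topology

noncomputable section

/-! ### Holomorphic germs at the origin of `ℂⁿ` -/

/-- The ring `𝒪ₙ` of germs at the origin of `ℂⁿ` of holomorphic functions. -/
def HolGerm (n : ℕ) : Subring (Filter.Germ (𝓝 (0 : Fin n → ℂ)) ℂ) where
  carrier := {γ |
    ∃ F : (Fin n → ℂ) → ℂ, AnalyticAt ℂ F 0 ∧ (F : Filter.Germ (𝓝 (0 : Fin n → ℂ)) ℂ) = γ}
  mul_mem' := by
    rintro _ _ ⟨F, hF, rfl⟩ ⟨G, hG, rfl⟩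
    exact ⟨F * G, hF.mul hG, rfl⟩
  one_mem' := ⟨fun _ => 1, analyticAt_const, rfl⟩
  add_mem' := by
    rintro _ _ ⟨F, hF, rfl⟩ ⟨G, hG, rfl⟩
    exact ⟨F + G, hF.add hG, rfl⟩
  zero_mem' := ⟨fun _ => 0, analyticAt_const, rfl⟩
  neg_mem' := by
    rintro _ ⟨F, hF, rfl⟩
    exact ⟨-F, hF.neg, rfl⟩

namespace HolGerm

variable {n : ℕ}

/-- The germ at the origin of a function that is holomorphic near the origin. -/
def mk (F : (Fin n → ℂ) → ℂ) (hF : AnalyticAt ℂ F 0) : HolGerm n :=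
  ⟨(F : Filter.Germ (𝓝 (0 : Fin n → ℂ)) ℂ), F, hF, rfl⟩

/-- The value of a germ at the origin, as a ring homomorphism `𝒪ₙ → ℂ`. -/
def valueHom (n : ℕ) : HolGerm n →+* ℂ :=
  (Filter.Germ.valueRingHom (X := Fin n → ℂ) (E := ℂ) (x := 0)).comp (HolGerm n).subtype

/-- The maximal ideal `𝔪ₙ` of `𝒪ₙ`: the germs that vanish at the origin. -/
def maxIdeal (n : ℕ) : Ideal (HolGerm n) := RingHom.ker (valueHom n)

/-- The partial derivative `∂/∂zᵢ` of a holomorphic germ. -/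
def partialDeriv (i : Fin n) (γ : HolGerm n) : HolGerm n :=
  ⟨Filter.Germ.map' (lc := 𝓝 (0 : Fin n → ℂ))
      (fun (F : (Fin n → ℂ) → ℂ) (z : Fin n → ℂ) => fderiv ℂ F z (Pi.single i 1))
      (fun _ _ h => h.fderiv.fun_comp fun L : (Fin n → ℂ) →L[ℂ] ℂ => L (Pi.single i 1)) γ.1, by
    obtain ⟨_, F, hF, rfl⟩ := γ
    exact ⟨fun z => fderiv ℂ F z (Pi.single i 1),
      ((ContinuousLinearMap.apply ℂ ℂ (Pi.single i (1 : ℂ) : Fin n → ℂ)).analyticAt _).comp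
        hF.fderiv, rfl⟩⟩

/-- The Jacobian ideal `J_g` of a germ `g`, generated by its first partial derivatives. -/
def jacobianIdeal (g : HolGerm n) : Ideal (HolGerm n) :=
  Ideal.span (Set.range fun i => partialDeriv i g)

/-- The invariant `a(g) = min {a ∈ ℕ : 𝔪ₙ ^ a ⊆ J_g + (g)}`; for an isolated hypersurface
singularity `g` the set is nonempty. -/
def aInv (g : HolGerm n) : ℕ :=
  sInf {a : ℕ | maxIdeal n ^ a ≤ jacobianIdeal g ⊔ Ideal.span {g}}

end HolGerm

/-! ### Projective hypersurfaces -/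

namespace Hypersurface

open MvPolynomial

variable {n : ℕ}

/-- The singular set of the hypersurface `V : f = 0` in `ℙⁿ`, for `f` homogeneous (so that the
conditions do not depend on the choice of homogeneous coordinates of the point). -/
def singularSet (f : MvPolynomial (Fin (n + 1)) ℂ) : Set (ℙ ℂ (Fin (n + 1) → ℂ)) :=
  {p | eval p.rep f = 0 ∧ ∀ j, eval p.rep (pderiv j f) = 0}

/-- The germ at the origin of `f ∘ φ`, for a holomorphic map germ `φ : (ℂⁿ, 0) → ℂⁿ⁺¹`. -/
def pullbackGerm (f : MvPolynomial (Fin (n + 1)) ℂ) (φ : (Fin n → ℂ) → (Fin (n + 1) → ℂ))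
    (hφ : AnalyticAt ℂ φ 0) : HolGerm n :=
  HolGerm.mk (fun z => eval (φ z) f) (by
    exact AnalyticAt.aeval_mvPolynomial (fun i => analyticAt_pi_iff.mp hφ i) f)

/-- `g = 0` is a local analytic equation of `V : f = 0` at `p`. Local holomorphic coordinates of
`ℙⁿ` centred at `p` are given by a holomorphic lift `φ : (ℂⁿ, 0) → ℂⁿ⁺¹ ∖ {0}` with `φ 0` on the
line `p`, whose composition with the projection to `ℙⁿ` is a local biholomorphism; the latter means
that the differential of `φ` at `0` maps `ℂⁿ` isomorphically onto a complement of the line `p`.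
In these coordinates, `g` has to agree with the equation `f ∘ φ` of `V` up to a unit of `𝒪ₙ`. -/
def IsLocalEquation (f : MvPolynomial (Fin (n + 1)) ℂ) (p : ℙ ℂ (Fin (n + 1) → ℂ))
    (g : HolGerm n) : Prop :=
  ∃ (φ : (Fin n → ℂ) → (Fin (n + 1) → ℂ)) (hφ : AnalyticAt ℂ φ 0) (h0 : φ 0 ≠ 0),
    Projectivization.mk ℂ (φ 0) h0 = p ∧
    Function.Bijective (fun x : ℂ × (Fin n → ℂ) => x.1 • φ 0 + fderiv ℂ φ 0 x.2) ∧
    Associated g (pullbackGerm f φ hφ)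

/-! ### Jacobian syzygies -/

/-- `AR(f)`: all relations `a₀ f_{x₀} + ⋯ + aₙ f_{xₙ} = 0` with `aⱼ ∈ S = ℂ[x₀, …, xₙ]`. -/
def AR (f : MvPolynomial (Fin (n + 1)) ℂ) :
    Submodule (MvPolynomial (Fin (n + 1)) ℂ) (Fin (n + 1) → MvPolynomial (Fin (n + 1)) ℂ) :=
  LinearMap.ker (Fintype.linearCombination (MvPolynomial (Fin (n + 1)) ℂ) fun j => pderiv j f)

/-- `KR(f)`: the submodule spanned by the Koszul relations
`f_{xⱼ} f_{xᵢ} + (-f_{xᵢ}) f_{xⱼ} = 0`. -/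
def KR (f : MvPolynomial (Fin (n + 1)) ℂ) :
    Submodule (MvPolynomial (Fin (n + 1)) ℂ) (Fin (n + 1) → MvPolynomial (Fin (n + 1)) ℂ) :=
  Submodule.span _ (Set.range fun ij : Fin (n + 1) × Fin (n + 1) =>
    Pi.single ij.1 (pderiv ij.2 f) - Pi.single ij.2 (pderiv ij.1 f))

theorem KR_le_AR (f : MvPolynomial (Fin (n + 1)) ℂ) : KR f ≤ AR f := by
  refine Submodule.span_le.mpr ?_
  rintro _ ⟨⟨i, j⟩, rfl⟩
  simp [AR, mul_comm]

/-- `ER(f) = AR(f) / KR(f)`, the module of essential relations. -/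
abbrev ER (f : MvPolynomial (Fin (n + 1)) ℂ) : Type :=
  AR f ⧸ (KR f).submoduleOf (AR f)

/-- `AR(f)ₘ`: the relations all of whose coefficients lie in `Sₘ`. -/
def ARdeg (f : MvPolynomial (Fin (n + 1)) ℂ) (m : ℕ) : Submodule ℂ (AR f) :=
  (Submodule.pi Set.univ fun _ => homogeneousSubmodule (Fin (n + 1)) ℂ m).comap
    ((AR f).subtype.restrictScalars ℂ)

/-- `ER(f)ₘ`: the homogeneous component of degree `m` of `ER(f)`, the image of `AR(f)ₘ`. -/
def ERdeg (f : MvPolynomial (Fin (n + 1)) ℂ) (m : ℕ) : Submodule ℂ (ER f) :=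
  (ARdeg f m).map (((KR f).submoduleOf (AR f)).mkQ.restrictScalars ℂ)

end Hypersurface

end

/-! Write N = e + 2 and let J be the Jacobian ideal, generated by forms of degree e + 1. As J has
finitely many projective zeros, an invertible constant matrix turns the partial derivatives into
combinations G_0, …, G_n for which I = (G_1, …, G_n) still has finitely many zeros
(`exists_generic_linearCombinations`), and some linear form ℓ vanishes at none of them. Then G_1, …,
G_n, ℓ is a complete intersection without projective zeros: the syzygies of G_1, …, G_n are Koszul,
ℓ is a nonzerodivisor modulo I, and the socle of S/(I + (ℓ)) lives in degrees at least n e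
(`hasKoszulSyzygiesAndSocle`, `HasKoszulSyzygiesAndSocle.of_linearForm`).

In a syzygy of G_0, …, G_n the coefficient b_0 of G_0 satisfies b_0 J ⊆ I, and the syzygy is Koszul
as soon as b_0 ∈ I (`SyzygiesKoszul.isKoszul_cons`). What remains is that (I : J) and I agree in
degrees m ≤ n e - Σ a(g_p) (`mem_span_of_mul_pderiv_mem`).

Let h ∈ (I : J) be homogeneous of such a degree m. By Euler's relation the Tjurina ideal of g_p is
generated by the pullbacks of the partial derivatives. Passing from holomorphic germs to
polynomials, any H vanishing to order a(g_p) at every singular point p lies in J locally at each of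
them (`exists_mul_mem_of_isLocalEquation`). So H h lies in I locally, and then in I itself because ℓ
is a nonzerodivisor (`mul_mem_of_mem_prod_lineIdeal`). Modulo ℓ these H include every polynomial of
order at least Σ a(g_p) at the origin, so the socle bound gives h ∈ I + (ℓ). In h = y + ℓ w with y ∈
I, the factor w is again in (I : J), of degree m - 1, and induction on m concludes. -/

section KoszulSyzygies

/-! ### Koszul syzygies as products with skew-symmetric matrices -/

open Matrix

variable {R : Type*} [CommRing R] {ι : Type*} [Fintype ι]

/-- `a` is a Koszul syzygy of `g`: it is the product of a skew-symmetric matrix with `g`. -/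
def IsKoszul (g a : ι → R) : Prop := ∃ M : Matrix ι ι R, Mᵀ = -M ∧ a = M *ᵥ g

/-- All syzygies of `g` are Koszul syzygies. -/
def SyzygiesKoszul (g : ι → R) : Prop := ∀ a : ι → R, a ⬝ᵥ g = 0 → IsKoszul g a

theorem IsKoszul.zero (g : ι → R) : IsKoszul g 0 := ⟨0, by simp, by simp⟩

theorem IsKoszul.add {g a b : ι → R} (ha : IsKoszul g a) (hb : IsKoszul g b) :
    IsKoszul g (a + b) := by
  obtain ⟨M, hM, rfl⟩ := ha
  obtain ⟨M', hM', rfl⟩ := hb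
  exact ⟨M + M', by rw [transpose_add, hM, hM', neg_add], by rw [add_mulVec]⟩

theorem IsKoszul.sum {κ : Type*} {g : ι → R} (s : Finset κ) (a : κ → ι → R)
    (h : ∀ k ∈ s, IsKoszul g (a k)) : IsKoszul g (∑ k ∈ s, a k) := by
  classical
  induction s using Finset.induction_on with
  | empty => simpa using IsKoszul.zero g
  | insert k s hk ih =>
    rw [Finset.sum_insert hk]
    exact (h k (Finset.mem_insert_self k s)).add
      (ih fun j hj => h j (Finset.mem_insert_of_mem hj))

theorem IsKoszul.smul {g a : ι → R} (ha : IsKoszul g a) (r : R) : IsKoszul g (r • a) := by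
  obtain ⟨M, hM, rfl⟩ := ha
  exact ⟨r • M, by rw [transpose_smul, hM, smul_neg], by rw [smul_mulVec]⟩

/-- A skew form takes a value x = -x on the diagonal. The condition Mᵀ = -M alone does not make this
zero; characteristic zero does. -/
theorem IsKoszul.dotProduct_eq_zero [IsDomain R] [CharZero R] {g a : ι → R}
    (ha : IsKoszul g a) : a ⬝ᵥ g = 0 := by
  obtain ⟨M, hM, rfl⟩ := ha
  have h : (M *ᵥ g) ⬝ᵥ g = -((M *ᵥ g) ⬝ᵥ g) := by
    conv_lhs => rw [dotProduct_comm, dotProduct_mulVec, ← mulVec_transpose, hM, neg_mulVec,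
      neg_dotProduct]
  exact self_eq_neg.mp h

/-- A Koszul syzygy of linear combinations of `f` gives a Koszul syzygy of `f`. -/
theorem IsKoszul.vecMul_of_mulVec {f b : ι → R} {A : Matrix ι ι R} (h : IsKoszul (A *ᵥ f) b) :
    IsKoszul f (b ᵥ* A) := by
  obtain ⟨M, hM, rfl⟩ := h
  refine ⟨Aᵀ * M * A, ?_, ?_⟩
  · simp [transpose_mul, hM, Matrix.mul_assoc]
  · rw [← mulVec_transpose, mulVec_mulVec, mulVec_mulVec, Matrix.mul_assoc]

theorem dotProduct_mem_span (a g : ι → R) : a ⬝ᵥ g ∈ Ideal.span (Set.range g) :=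
  Ideal.sum_mem _ fun i _ => Ideal.mul_mem_left _ _ (Ideal.subset_span ⟨i, rfl⟩)

theorem exists_dotProduct_of_mem_span {g : ι → R} {x : R} (h : x ∈ Ideal.span (Set.range g)) :
    ∃ a : ι → R, x = a ⬝ᵥ g := by
  obtain ⟨c, hc⟩ := (Ideal.mem_span_range_iff_exists_fun).mp h
  exact ⟨c, hc.symm⟩

/-- If all syzygies of `g` are Koszul and the first coefficient of a syzygy of `q, g` is in the
ideal generated by `g`, then that syzygy is Koszul. -/
theorem SyzygiesKoszul.isKoszul_cons {r : ℕ} {g : Fin r → R} (hg : SyzygiesKoszul g) {q a₀ : R}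
    {a : Fin r → R} (h : a₀ * q + a ⬝ᵥ g = 0) (ha₀ : a₀ ∈ Ideal.span (Set.range g)) :
    IsKoszul (Fin.cons q g : Fin (r + 1) → R) (Fin.cons a₀ a) := by
  obtain ⟨b, rfl⟩ := exists_dotProduct_of_mem_span ha₀
  obtain ⟨M, hM, hMa⟩ := hg (a + q • b) (by
    rw [add_dotProduct, smul_dotProduct, smul_eq_mul, ← h]; ring)
  -- With a₀ = b · g, the vector a + q b is a syzygy of g, equal to M g. Bordering M by the row b
  -- and the column -b gives a skew matrix that sends (q, g) to (b · g, M g - q b).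
  refine ⟨Matrix.of (Fin.cons (Fin.cons 0 b) fun i => Fin.cons (-b i) (M i)), ?_, ?_⟩
  · ext i j
    refine Fin.cases ?_ (fun i => ?_) i <;> refine Fin.cases ?_ (fun j => ?_) j
    · simp
    · simp
    · simp
    · simpa using congrFun (congrFun hM i) j
  · ext i
    refine Fin.cases ?_ (fun i => ?_) i
    · simp [mulVec, dotProduct, Fin.sum_univ_succ]
    · have := congrFun hMa i
      simp only [Pi.add_apply, Pi.smul_apply, smul_eq_mul] at this
      rw [Fin.cons_succ, eq_sub_of_add_eq this]
      simp [mulVec, dotProduct, Fin.sum_univ_succ]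
      ring

end KoszulSyzygies

/-! ### Reduction of syzygies modulo a linear form -/

namespace MvPolynomial

variable {K : Type*} [Field K] {n : ℕ}

attribute [local instance] MvPolynomial.gradedAlgebra

/-- This cuts relations down to their graded pieces. The case d > m is separate because m - d is a
truncated subtraction. -/
theorem homogeneousComponent_mul_of_isHomogeneous {σ : Type*} {p q : MvPolynomial σ K} {d : ℕ}
    (hq : q.IsHomogeneous d) (m : ℕ) :
    homogeneousComponent m (p * q) =
      if d ≤ m then homogeneousComponent (m - d) p * q else 0 := by
  have key : ∀ i, homogeneousComponent m (homogeneousComponent i p * q) =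
      if i + d = m then homogeneousComponent i p * q else 0 := fun i =>
    (homogeneousComponent_of_mem ((homogeneousComponent_isHomogeneous i p).mul hq)).trans
      (by simp only [eq_comm])
  conv_lhs => rw [← sum_homogeneousComponent p, Finset.sum_mul, map_sum]
  simp only [key]
  split_ifs with h
  · rw [Finset.sum_eq_single (m - d)]
    · rw [if_pos (by omega)]
    · exact fun i _ hi => if_neg (by omega)
    · intro hi
      rw [homogeneousComponent_eq_zero _ _ (by simp at hi; omega), zero_mul, ite_self]
  · exact Finset.sum_eq_zero fun i _ => if_neg (by omega)

/-- The linear form with coefficients `c`. -/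
noncomputable def linearForm (c : Fin n → K) : MvPolynomial (Fin n) K := ∑ i, C (c i) * X i

theorem isHomogeneous_linearForm (c : Fin n → K) : (linearForm c).IsHomogeneous 1 :=
  IsHomogeneous.sum _ _ _ fun i _ => isHomogeneous_C_mul_X (c i) i

@[simp] theorem eval_linearForm (c x : Fin n → K) : eval x (linearForm c) = c ⬝ᵥ x := by
  simp [linearForm, dotProduct]

/-- The quotient of a polynomial ring by a linear form is a polynomial ring. -/
theorem exists_quotient_linearForm {c : Fin (n + 1) → K} (hc : c ≠ 0) :
    ∃ π : MvPolynomial (Fin (n + 1)) K →+* MvPolynomial (Fin n) K,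
      Function.Surjective π ∧ RingHom.ker π = Ideal.span {linearForm c} ∧
      (∀ p m, p.IsHomogeneous m → (π p).IsHomogeneous m) ∧ ∀ i, ∃ j, π (X j) = X i := by
  obtain ⟨j, hj⟩ := Function.ne_iff.mp hc
  simp only [Pi.zero_apply] at hj
  -- The value of X j obtained by solving the equation of the hyperplane for it, as c j ≠ 0.
  set s : MvPolynomial (Fin n) K := -∑ i, C (c j)⁻¹ * C (c (j.succAbove i)) * X i with hs
  let y : Fin (n + 1) → MvPolynomial (Fin n) K := j.insertNth s X
  let σ : MvPolynomial (Fin n) K →ₐ[K] MvPolynomial (Fin (n + 1)) K :=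
    aeval fun i => X (j.succAbove i)
  have hcc : (C (c j) : MvPolynomial (Fin n) K) * C (c j)⁻¹ = 1 := by
    rw [← C_mul, mul_inv_cancel₀ hj, C_1]
  have hcc' : (C (c j) : MvPolynomial (Fin (n + 1)) K) * C (c j)⁻¹ = 1 := by
    rw [← C_mul, mul_inv_cancel₀ hj, C_1]
  refine ⟨(aeval y : MvPolynomial (Fin (n + 1)) K →ₐ[K] MvPolynomial (Fin n) K).toRingHom,
    ?_, ?_, ?_, ?_⟩
  · refine fun p => ⟨σ p, ?_⟩
    have : (aeval y).comp σ = AlgHom.id K _ := by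
      ext i
      simp [σ, y]
    exact DFunLike.congr_fun this p
  · apply le_antisymm
    · intro p hp
      have key : (Ideal.Quotient.mkₐ K (Ideal.span {linearForm c})).comp (σ.comp (aeval y)) =
          Ideal.Quotient.mkₐ K (Ideal.span {linearForm c}) := by
        ext i
        refine j.succAboveCases ?_ (fun i => ?_) i
        · simp only [AlgHom.comp_apply, aeval_X, Ideal.Quotient.mkₐ_eq_mk, y,
            Fin.insertNth_apply_same]
          rw [Ideal.Quotient.eq, Ideal.mem_span_singleton]
          refine ⟨-C (c j)⁻¹, ?_⟩
          simp only [hs, map_neg, map_sum, map_mul, linearForm, Fin.sum_univ_succAbove _ j, σ,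
            aeval_X, algHom_C, algebraMap_eq]
          rw [mul_comm _ (-C (c j)⁻¹), mul_add, Finset.mul_sum]
          have : -C (c j)⁻¹ * (C (c j) * X j) = -(X j : MvPolynomial (Fin (n + 1)) K) := by
            linear_combination (-X j) * hcc'
          have h2 : ∑ i, -C (c j)⁻¹ * (C (c (j.succAbove i)) * X (j.succAbove i)) =
              -∑ i, (C (c j)⁻¹ * C (c (j.succAbove i)) * X (j.succAbove i) :
                MvPolynomial (Fin (n + 1)) K) := by
            rw [← Finset.sum_neg_distrib]
            exact Finset.sum_congr rfl fun i _ => by ring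
          rw [this, h2]
          ring
        · simp [y, σ]
      have := DFunLike.congr_fun key p
      rw [RingHom.mem_ker] at hp
      have hp' : aeval y p = 0 := hp
      simp only [AlgHom.comp_apply, hp', map_zero] at this
      exact Ideal.Quotient.eq_zero_iff_mem.mp this.symm
    · rw [Ideal.span_singleton_le_iff_mem, RingHom.mem_ker]
      change aeval y (linearForm c) = 0
      rw [linearForm, Fin.sum_univ_succAbove _ j, map_add, map_sum]
      simp only [map_mul, aeval_X, algHom_C, algebraMap_eq, y, Fin.insertNth_apply_same,
        Fin.insertNth_apply_succAbove]
      rw [hs, mul_neg, Finset.mul_sum, neg_add_eq_zero]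
      refine Finset.sum_congr rfl fun i _ => ?_
      linear_combination (C (c (j.succAbove i)) * X i) * hcc
  · intro p m hp
    have h1 : ∀ i, (y i).IsHomogeneous 1 := by
      intro i
      refine j.succAboveCases ?_ (fun i => ?_) i
      · simp only [y, Fin.insertNth_apply_same, hs]
        refine (IsHomogeneous.sum _ _ _ fun i _ => ?_).neg
        rw [← C_mul]
        exact isHomogeneous_C_mul_X _ i
      · simp only [y, Fin.insertNth_apply_succAbove]
        exact isHomogeneous_X K i
    simpa using hp.aeval y h1
  · exact fun i => ⟨j.succAbove i, by simp [y]⟩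

section Descent

variable {m : ℕ} {r : ℕ} {c : Fin (n + 1) → K}

/-- Membership modulo the linear form that generates the kernel of `π`. -/
theorem mem_sup_span_iff_map_mem {R A : Type*} [CommRing R] [CommRing A]
    {π : R →+* A} {ℓ : R} (hπ : Function.Surjective π) (hker : RingHom.ker π = Ideal.span {ℓ})
    {κ : Type*} {g : κ → R} {p : R} :
    p ∈ Ideal.span (Set.range g) ⊔ Ideal.span {ℓ} ↔
      π p ∈ Ideal.span (Set.range fun i => π (g i)) := by
  have : Ideal.span (Set.range fun i => π (g i)) = (Ideal.span (Set.range g)).map π := by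
    rw [Ideal.map_span, ← Set.range_comp]; rfl
  rw [this, ← Ideal.mem_comap, Ideal.comap_map_of_surjective π hπ, ← RingHom.ker_eq_comap_bot, hker]

/-- Lifting a Koszul syzygy of a reduction modulo `ℓ`. -/
theorem IsKoszul.exists_lift {R A : Type*} [CommRing R] [CommRing A] {π : R →+* A} {ℓ : R}
    (hπ : Function.Surjective π) (hker : RingHom.ker π = Ideal.span {ℓ}) (h2 : IsUnit (2 : R))
    {g a : Fin r → R} (h : IsKoszul (fun i => π (g i)) fun i => π (a i)) :
    ∃ (M : Matrix (Fin r) (Fin r) R) (b : Fin r → R), M.transpose = -M ∧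
      a = M.mulVec g + ℓ • b := by
  obtain ⟨N, hN, hNa⟩ := h
  obtain ⟨u, hu⟩ := h2.exists_left_inv
  choose L hL using fun i j => hπ (N i j)
  -- Entrywise lifts of N need not form a skew matrix; with u = 1/2 their skew part is still a lift
  -- of N.
  let M : Matrix (Fin r) (Fin r) R := Matrix.of fun i j => u * (L i j - L j i)
  have hM : ∀ i j, π (M i j) = N i j := by
    intro i j
    have h1 : N j i = -N i j := congrFun (congrFun hN i) j
    have h3 : π u * 2 = 1 := by
      rw [← map_ofNat π 2, ← map_mul, hu, map_one]
    simp only [M, Matrix.of_apply, map_mul, map_sub, hL, h1]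
    linear_combination N i j * h3
  have hab : ∀ i, ∃ b, a i - M.mulVec g i = ℓ * b := by
    intro i
    rw [← dvd_def, ← Ideal.mem_span_singleton, ← hker, RingHom.mem_ker, map_sub, sub_eq_zero]
    refine (congrFun hNa i).trans ?_
    simp [Matrix.mulVec, dotProduct, hM]
  choose b hb using hab
  refine ⟨M, b, ?_, ?_⟩
  · ext i j
    simp only [Matrix.transpose_apply, Matrix.neg_apply, M, Matrix.of_apply]
    ring
  · ext i
    simp [← hb i]

/-- If all syzygies of the reduction of `g` modulo `ℓ` are Koszul, then `ℓ` is a nonzerodivisor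
modulo the ideal generated by `g`. -/
theorem mem_span_of_mul_mem_span {R A : Type*} [CommRing R] [IsDomain R]
    [CharZero R] [CommRing A] {π : R →+* A} {ℓ : R} (hℓ : ℓ ≠ 0)
    (hπ : Function.Surjective π) (hker : RingHom.ker π = Ideal.span {ℓ}) (h2 : IsUnit (2 : R))
    {g : Fin r → R} (hK : SyzygiesKoszul fun i => π (g i)) {b : R}
    (h : ℓ * b ∈ Ideal.span (Set.range g)) : b ∈ Ideal.span (Set.range g) := by
  obtain ⟨a, ha⟩ := exists_dotProduct_of_mem_span h
  have hπℓ : π ℓ = 0 := by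
    rw [← RingHom.mem_ker, hker]; exact Ideal.mem_span_singleton_self ℓ
  obtain ⟨M, e, hM, hae⟩ := IsKoszul.exists_lift hπ hker h2 (hK (fun i => π (a i)) (by
    have := congrArg π ha
    rw [map_mul, hπℓ, zero_mul] at this
    simpa [dotProduct] using this.symm))
  -- The skew part contributes nothing, which leaves ℓ b = ℓ (e · g) with ℓ cancellable.
  have h0 : M.mulVec g ⬝ᵥ g = 0 := IsKoszul.dotProduct_eq_zero ⟨M, hM, rfl⟩
  rw [hae, add_dotProduct, h0, zero_add, smul_dotProduct, smul_eq_mul] at ha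
  rw [mul_left_cancel₀ hℓ ha]
  exact dotProduct_mem_span e g

theorem linearForm_ne_zero {c : Fin n → K} (hc : c ≠ 0) : linearForm c ≠ 0 := by
  classical
  obtain ⟨j, hj⟩ := Function.ne_iff.mp hc
  intro h
  apply hj
  simpa [h] using (eval_linearForm c (Pi.single j 1)).symm

theorem isUnit_two [CharZero K] {σ : Type*} : IsUnit (2 : MvPolynomial σ K) := by
  have : (2 : MvPolynomial σ K) = C (2 : K) := (map_ofNat C 2).symm
  rw [this]
  exact (IsUnit.mk0 (2 : K) two_ne_zero).map C

/-- If `g` has homogeneous entries of the same degree and all homogeneous syzygies of `g` are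
Koszul, then all syzygies are. -/
theorem SyzygiesKoszul.of_homogeneous {d : ℕ} {g : Fin r → MvPolynomial (Fin n) K}
    (hg : ∀ i, (g i).IsHomogeneous d)
    (h : ∀ m a, (∀ i, (a i).IsHomogeneous m) → a ⬝ᵥ g = 0 → IsKoszul g a) :
    SyzygiesKoszul g := by
  intro a ha
  set D := Finset.univ.sup fun i => (a i).totalDegree with hD
  have hsum : a = ∑ m ∈ Finset.range (D + 1), fun i => homogeneousComponent m (a i) := by
    ext1 i
    rw [Finset.sum_apply]
    conv_lhs => rw [← sum_homogeneousComponent (a i)]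
    refine Finset.sum_subset (Finset.range_mono (Nat.succ_le_succ
      (Finset.le_sup (f := fun i => (a i).totalDegree) (Finset.mem_univ i)))) fun m _ hm => ?_
    exact homogeneousComponent_eq_zero _ _ (by simpa using hm)
  rw [hsum]
  refine IsKoszul.sum _ _ fun m _ => h m _ (fun i => homogeneousComponent_isHomogeneous m _) ?_
  have := congrArg (homogeneousComponent (m + d)) ha
  simpa [dotProduct, homogeneousComponent_mul_of_isHomogeneous (hg _)] using this

/-- Syzygies of `g` are Koszul if those of its reduction modulo a linear form are. -/
theorem SyzygiesKoszul.of_quotient [CharZero K] {d : ℕ} (hc : c ≠ 0)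
    {π : MvPolynomial (Fin (n + 1)) K →+* MvPolynomial (Fin n) K}
    (hπ : Function.Surjective π) (hker : RingHom.ker π = Ideal.span {linearForm c})
    {g : Fin r → MvPolynomial (Fin (n + 1)) K} (hg : ∀ i, (g i).IsHomogeneous d)
    (hK : SyzygiesKoszul fun i => π (g i)) : SyzygiesKoszul g := by
  refine SyzygiesKoszul.of_homogeneous hg fun m => ?_
  induction m using Nat.strong_induction_on with
  | _ m ih =>
  intro a ha hag
  obtain ⟨M, b, hM, hab⟩ := IsKoszul.exists_lift hπ hker isUnit_two
    (hK (fun i => π (a i)) (by simpa [dotProduct] using congrArg π hag))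
  -- Taking the graded pieces of M and b keeps the relation a = M g + ℓ b and makes b homogeneous of
  -- degree m - 1, so that the induction applies to it.
  let M' : Matrix (Fin r) (Fin r) (MvPolynomial (Fin (n + 1)) K) :=
    Matrix.of fun i j => if d ≤ m then homogeneousComponent (m - d) (M i j) else 0
  let b' : Fin r → MvPolynomial (Fin (n + 1)) K :=
    fun i => if 1 ≤ m then homogeneousComponent (m - 1) (b i) else 0
  have hM' : M'.transpose = -M' := by
    ext1 i j
    have h1 : M j i = -M i j := congrFun (congrFun hM i) j
    simp only [M', Matrix.transpose_apply, Matrix.neg_apply, Matrix.of_apply, h1]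
    split_ifs <;> simp
  have hab' : a = M'.mulVec g + linearForm c • b' := by
    ext1 i
    have := congrArg (homogeneousComponent m) (congrFun hab i)
    rw [homogeneousComponent_eq_self (ha i)] at this
    rw [this]
    simp only [Pi.add_apply, Pi.smul_apply, smul_eq_mul, Matrix.mulVec, dotProduct, map_add,
      map_sum, homogeneousComponent_mul_of_isHomogeneous (hg _), mul_comm (linearForm c),
      homogeneousComponent_mul_of_isHomogeneous (isHomogeneous_linearForm c), M', b',
      Matrix.of_apply, ite_mul, zero_mul]
  have hK0 : IsKoszul g (M'.mulVec g) := ⟨M', hM', rfl⟩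
  rw [hab'] at hag ⊢
  rw [add_dotProduct, hK0.dotProduct_eq_zero, zero_add, smul_dotProduct, smul_eq_mul] at hag
  refine hK0.add (IsKoszul.smul ?_ _)
  by_cases hm : 1 ≤ m
  · refine ih (m - 1) (by omega) b' (fun i => ?_)
      ((mul_eq_zero.mp hag).resolve_left (linearForm_ne_zero hc))
    simp only [b', if_pos hm]
    exact homogeneousComponent_isHomogeneous _ _
  · have : b' = 0 := by ext1 i; simp [b', hm]
    rw [this]
    exact IsKoszul.zero g

end Descent

theorem mem_of_pow_mul_mem {R : Type*} [CommRing R] {I : Ideal R} {ℓ : R}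
    (hℓ : ∀ b, ℓ * b ∈ I → b ∈ I) {b : R} {k : ℕ} (h : ℓ ^ k * b ∈ I) : b ∈ I := by
  induction k with
  | zero => simpa using h
  | succ k ih => exact ih (hℓ _ (by rwa [← mul_assoc, ← pow_succ']))

/-- If `ℓ` is a nonzerodivisor modulo `I` and a power of `ℓ` is in `I + (q)`, then `q` is a
nonzerodivisor modulo `I`. -/
theorem mem_of_mul_mem_of_mem_radical {R : Type*} [CommRing R] {I : Ideal R} {ℓ q : R}
    (hℓ : ∀ b, ℓ * b ∈ I → b ∈ I) (h : ℓ ∈ (I ⊔ Ideal.span {q}).radical) {b : R}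
    (hb : q * b ∈ I) : b ∈ I := by
  obtain ⟨k, hk⟩ := h
  obtain ⟨x, hx, y, hy, hxy⟩ := Submodule.mem_sup.mp hk
  obtain ⟨w, rfl⟩ := Ideal.mem_span_singleton'.mp hy
  refine mem_of_pow_mul_mem hℓ (k := k) ?_
  rw [← hxy, add_mul, mul_assoc]
  exact I.add_mem (I.mul_mem_right _ hx) (I.mul_mem_left _ hb)

/-- Exchange of the last generator in the socle computation. -/
theorem mem_sup_span_of_socle {R ι : Type*} [CommRing R] {I : Ideal R} {ℓ q h u : R} {x : ι → R}
    (hℓ : ∀ b, ℓ * b ∈ I → b ∈ I) (hq : ∀ b, q * b ∈ I → b ∈ I)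
    (hx : ∀ i, x i * h ∈ I ⊔ Ideal.span {q}) (hu : ℓ * h - q * u ∈ I)
    (hsoc : (∀ i, x i * u ∈ I ⊔ Ideal.span {ℓ}) → u ∈ I ⊔ Ideal.span {ℓ}) :
    h ∈ I ⊔ Ideal.span {q} := by
  have key : u ∈ I ⊔ Ideal.span {ℓ} := by
    refine hsoc fun i => ?_
    obtain ⟨y, hy, z, hz, hyz⟩ := Submodule.mem_sup.mp (hx i)
    obtain ⟨v, rfl⟩ := Ideal.mem_span_singleton'.mp hz
    have h1 : x i * u - v * ℓ ∈ I := by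
      apply hq
      have : q * (x i * u - v * ℓ) = ℓ * y - x i * (ℓ * h - q * u) := by
        linear_combination (-ℓ) * hyz
      rw [this]
      exact I.sub_mem (I.mul_mem_left _ hy) (I.mul_mem_left _ hu)
    exact Submodule.mem_sup.mpr ⟨_, h1, _, Ideal.mem_span_singleton'.mpr ⟨v, rfl⟩, by ring⟩
  obtain ⟨y, hy, z, hz, hyz⟩ := Submodule.mem_sup.mp key
  obtain ⟨w, rfl⟩ := Ideal.mem_span_singleton'.mp hz
  have h1 : h - w * q ∈ I := by
    apply hℓ
    have : ℓ * (h - w * q) = (ℓ * h - q * u) + q * y := by linear_combination (-q) * hyz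
    rw [this]
    exact I.add_mem hu (I.mul_mem_left _ hy)
  exact Submodule.mem_sup.mpr ⟨_, h1, _, Ideal.mem_span_singleton'.mpr ⟨w, rfl⟩, by ring⟩

end MvPolynomial

/-! ### Complete intersections: prime avoidance, syzygies and socle degree -/

namespace MvPolynomial

variable {K : Type*} [Field K] {n : ℕ}

attribute [local instance] MvPolynomial.gradedAlgebra

/-- The homogeneous core of P is prime and still contains I, so minimality forces it to be P. -/
theorem isHomogeneous_of_mem_minimalPrimes {σ : Type*} {I P : Ideal (MvPolynomial σ K)}
    (hI : I.IsHomogeneous (homogeneousSubmodule σ K)) (hP : P ∈ I.minimalPrimes) :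
    P.IsHomogeneous (homogeneousSubmodule σ K) := by
  have h := hP.1.1.homogeneousCore (𝒜 := homogeneousSubmodule σ K)
  have hle : (P.homogeneousCore (homogeneousSubmodule σ K)).toIdeal ≤ P :=
    Ideal.toIdeal_homogeneousCore_le _ P
  have hI' : I ≤ (P.homogeneousCore (homogeneousSubmodule σ K)).toIdeal := by
    rw [← hI.toIdeal_homogeneousCore_eq_self]
    exact Ideal.homogeneousCore_mono _ hP.1.2
  have := hP.2 ⟨h, hI'⟩ hle
  rw [Ideal.IsHomogeneous.iff_eq]
  exact le_antisymm hle this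

theorem isHomogeneous_span_range {ι σ : Type*} {d : ℕ} {g : ι → MvPolynomial σ K}
    (hg : ∀ i, (g i).IsHomogeneous d) :
    (Ideal.span (Set.range g)).IsHomogeneous (homogeneousSubmodule σ K) := by
  refine Ideal.homogeneous_span _ _ ?_
  rintro _ ⟨i, rfl⟩
  exact ⟨d, hg i⟩

/-- A proper homogeneous ideal is contained in the ideal generated by the variables. -/
theorem le_span_X_of_isHomogeneous {σ : Type*} {I : Ideal (MvPolynomial σ K)}
    (hI : I.IsHomogeneous (homogeneousSubmodule σ K)) (hne : I ≠ ⊤) :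
    I ≤ idealOfVars σ K := by
  intro p hp
  have h0 : homogeneousComponent 0 p ∈ I := homogeneousComponent_mem_of_mem hI hp 0
  rw [homogeneousComponent_zero] at h0
  have hc : coeff 0 p = 0 := by
    by_contra hc
    exact hne (Ideal.eq_top_of_isUnit_mem _ h0 ((IsUnit.mk0 _ hc).map C))
  rw [idealOfVars, ← Set.image_univ, mem_ideal_span_X_image]
  intro m hm
  have : m ≠ 0 := by
    rintro rfl
    exact (mem_support_iff.mp hm) hc
  obtain ⟨i, hi⟩ := Finsupp.ne_iff.mp this
  exact ⟨i, Set.mem_univ i, hi⟩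

/-- A vector outside of a proper subspace whose image avoids finitely many ideals. -/
theorem exists_notMem_of_finite [Infinite K] {E R : Type*} [AddCommGroup E] [Module K E]
    [CommRing R] [Algebra K R] (L : E →ₗ[K] R) {T : Set (Ideal R)} (hT : T.Finite)
    (h : ∀ P ∈ T, ∃ e, L e ∉ P) {W : Submodule K E} (hW : W ≠ ⊤) :
    ∃ e, e ∉ W ∧ ∀ P ∈ T, L e ∉ P := by
  classical
  -- A vector space over an infinite field is not a finite union of proper subspaces: here W and the
  -- preimages of the ideals in T.
  let s : Finset (Subspace K E) := insert W
    (hT.toFinset.image fun P => (P.restrictScalars K).comap L)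
  have hs : ⊤ ∉ s := by
    simp only [s, Finset.mem_insert, Finset.mem_image, Set.Finite.mem_toFinset, not_or]
    refine ⟨hW.symm, ?_⟩
    rintro ⟨P, hP, hPtop⟩
    obtain ⟨e, he⟩ := h P hP
    have : e ∈ (P.restrictScalars K).comap L := hPtop ▸ Submodule.mem_top
    exact he this
  obtain ⟨e, he⟩ := (Set.ne_univ_iff_exists_notMem _).mp (Subspace.biUnion_ne_univ_of_top_notMem hs)
  simp only [Set.mem_iUnion, not_exists, SetLike.mem_coe] at he
  refine ⟨e, he W (Finset.mem_insert_self _ _), fun P hP hLe => ?_⟩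
  exact he _ (Finset.mem_insert_of_mem (Finset.mem_image_of_mem _ (hT.mem_toFinset.mpr hP))) hLe

/-- Every homogeneous prime strictly above a homogeneous prime over `I` contains all variables:
the projective zero set of `I` has dimension at most zero. -/
def ProjDimLEZero (I : Ideal (MvPolynomial (Fin n) K)) : Prop :=
  ∀ P Q : Ideal (MvPolynomial (Fin n) K), P.IsPrime → Q.IsPrime →
    P.IsHomogeneous (homogeneousSubmodule (Fin n) K) →
    Q.IsHomogeneous (homogeneousSubmodule (Fin n) K) → I ≤ P → P < Q → ∀ i, X i ∈ Q

theorem linearCombination_X (c : Fin n → K) :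
    Fintype.linearCombination K (X : Fin n → MvPolynomial (Fin n) K) c = linearForm c := by
  simp [linearForm, Fintype.linearCombination_apply, smul_eq_C_mul]

/-- Take ℓ outside the finitely many minimal primes of I that miss some variable. A minimal prime of
I + (ℓ) lies above a minimal prime of I, strictly so if that one misses a variable; in either case
it contains all variables. -/
theorem exists_linearForm_of_projDimLEZero [Infinite K] {I : Ideal (MvPolynomial (Fin (n + 1)) K)}
    (hI : I.IsHomogeneous (homogeneousSubmodule (Fin (n + 1)) K)) (h : ProjDimLEZero I) :
    ∃ c : Fin (n + 1) → K, c ≠ 0 ∧ ∀ i, X i ∈ (I ⊔ Ideal.span {linearForm c}).radical := by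
  classical
  obtain ⟨c, hc0, hc⟩ := exists_notMem_of_finite
    (Fintype.linearCombination K (X : Fin (n + 1) → MvPolynomial (Fin (n + 1)) K))
    (T := {P ∈ I.minimalPrimes | ∃ i, X i ∉ P})
    ((I.finite_minimalPrimes_of_isNoetherianRing).subset (Set.sep_subset _ _))
    (fun P hP => by
      obtain ⟨i, hi⟩ := hP.2
      exact ⟨Pi.single i 1, by simpa using hi⟩)
    (W := ⊥) bot_ne_top
  refine ⟨c, by simpa using hc0, fun i => ?_⟩
  rw [← Ideal.sInf_minimalPrimes, Ideal.mem_sInf]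
  intro Q hQ
  have hhom : (I ⊔ Ideal.span {linearForm c}).IsHomogeneous
      (homogeneousSubmodule (Fin (n + 1)) K) :=
    hI.sup (Ideal.homogeneous_span _ _ (by
      rintro _ rfl
      exact ⟨1, isHomogeneous_linearForm c⟩))
  have hQp := hQ.1.1
  obtain ⟨P, hP, hPQ⟩ := Ideal.exists_minimalPrimes_le (le_sup_left.trans hQ.1.2)
  by_cases hX : ∃ i, X i ∉ P
  · refine h P Q hP.1.1 hQ.1.1 (isHomogeneous_of_mem_minimalPrimes hI hP)
      (isHomogeneous_of_mem_minimalPrimes hhom hQ) hP.1.2 (lt_of_le_of_ne hPQ ?_) i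
    rintro rfl
    refine hc P ⟨hP, hX⟩ ?_
    rw [linearCombination_X]
    exact hQ.1.2 (le_sup_right (a := I) (Ideal.mem_span_singleton_self _))
  · push Not at hX
    exact hPQ (hX i)

theorem idealOfVars_eq_ker {σ : Type*} : idealOfVars σ K = RingHom.ker (constantCoeff (R := K)) := by
  ext p
  have := mem_pow_idealOfVars_iff' (σ := σ) (R := K) 1 p
  rw [pow_one] at this
  rw [this, RingHom.mem_ker, constantCoeff_eq]
  refine ⟨fun h => h 0 (by simp), fun h x hx => ?_⟩
  have : x = 0 := by
    rw [← Finsupp.degree_eq_zero_iff]; omega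
  rwa [this]

theorem isPrime_idealOfVars {σ : Type*} : (idealOfVars σ K).IsPrime := by
  rw [idealOfVars_eq_ker]
  exact RingHom.ker_isPrime _

theorem idealOfVars_le_iff {σ : Type*} {I : Ideal (MvPolynomial σ K)} :
    idealOfVars σ K ≤ I ↔ ∀ i, X i ∈ I := by
  rw [idealOfVars, Ideal.span_le, Set.range_subset_iff]
  rfl

theorem X_mem_idealOfVars {σ : Type*} (i : σ) : X i ∈ idealOfVars σ K :=
  Ideal.subset_span ⟨i, rfl⟩

theorem IsHomogeneous.mem_idealOfVars {σ : Type*} {p : MvPolynomial σ K} {d : ℕ}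
    (hp : p.IsHomogeneous d) (hd : d ≠ 0) : p ∈ idealOfVars σ K := by
  rw [idealOfVars_eq_ker, RingHom.mem_ker, constantCoeff_eq]
  exact hp.coeff_eq_zero (by simpa using hd.symm)

/-- Krull's principal ideal theorem, relative to P: the ideal of the variables is minimal over P +
(q), so no prime fits strictly between it and P. -/
theorem projDimLEZero_of_radical {I : Ideal (MvPolynomial (Fin n) K)} {q : MvPolynomial (Fin n) K}
    (hq : q ∈ idealOfVars (Fin n) K)
    (h : ∀ i, X i ∈ (I ⊔ Ideal.span {q}).radical) : ProjDimLEZero I := by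
  intro P Q hP hQ hPh hQh hIP hPQ
  rw [← idealOfVars_le_iff]
  have hQm : Q ≤ idealOfVars (Fin n) K := le_span_X_of_isHomogeneous hQh hQ.ne_top
  by_contra hcon
  have hlt : Q < idealOfVars (Fin n) K := lt_of_le_not_ge hQm hcon
  have hprime := isPrime_idealOfVars (K := K) (σ := Fin n)
  have hmin : idealOfVars (Fin n) K ∈ (Ideal.span (insert q (P : Set _))).minimalPrimes := by
    refine ⟨⟨hprime, ?_⟩, ?_⟩
    · rw [Ideal.span_le, Set.insert_subset_iff]
      exact ⟨hq, hPQ.le.trans hQm⟩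
    · rintro Q' ⟨hQ', hle⟩ -
      rw [Ideal.span_le, Set.insert_subset_iff] at hle
      rw [idealOfVars_le_iff]
      intro i
      refine (hQ'.radical_le_iff.mpr (sup_le (hIP.trans hle.2) ?_)) (h i)
      rw [Ideal.span_singleton_le_iff_mem]
      exact hle.1
  have := Ideal.mem_minimalPrimes_span_of_mem_minimalPrimes_span_insert hlt q P hmin P hPQ.le
    ((Set.subset_insert q (P : Set _)).trans (Ideal.subset_span.trans Ideal.le_radical))
  rw [Ideal.span_eq] at this
  exact absurd (this.2 ⟨hP, le_rfl⟩ hPQ.le) hPQ.not_ge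

/-- For `n` forms of degree `e + 1` in `n` variables without common projective zeros, the syzygies
are Koszul and the socle of the quotient lives in degrees at least `n * e`. -/
def HasKoszulSyzygiesAndSocle (K : Type*) [Field K] (e n : ℕ) : Prop :=
  ∀ g : Fin n → MvPolynomial (Fin n) K, (∀ i, (g i).IsHomogeneous (e + 1)) →
    (∀ i, X i ∈ (Ideal.span (Set.range g)).radical) →
    SyzygiesKoszul g ∧ ∀ m (h : MvPolynomial (Fin n) K), h.IsHomogeneous m → m < n * e →
      (∀ i, X i * h ∈ Ideal.span (Set.range g)) → h ∈ Ideal.span (Set.range g)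

/-- Consequences in `n + 1` variables, for `n` forms and a linear form without common projective
zeros. -/
theorem HasKoszulSyzygiesAndSocle.of_linearForm [CharZero K] {e n : ℕ}
    (hT : HasKoszulSyzygiesAndSocle K e n) {g : Fin n → MvPolynomial (Fin (n + 1)) K}
    (hg : ∀ i, (g i).IsHomogeneous (e + 1)) {c : Fin (n + 1) → K} (hc : c ≠ 0)
    (hrad : ∀ i, X i ∈ (Ideal.span (Set.range g) ⊔ Ideal.span {linearForm c}).radical) :
    SyzygiesKoszul g ∧
    (∀ b, linearForm c * b ∈ Ideal.span (Set.range g) → b ∈ Ideal.span (Set.range g)) ∧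
    ∀ m (h : MvPolynomial (Fin (n + 1)) K), h.IsHomogeneous m → m < n * e →
      (∀ i, X i * h ∈ Ideal.span (Set.range g) ⊔ Ideal.span {linearForm c}) →
      h ∈ Ideal.span (Set.range g) ⊔ Ideal.span {linearForm c} := by
  obtain ⟨π, hπ, hker, hhom, hX⟩ := exists_quotient_linearForm hc
  have hmem := fun p => mem_sup_span_iff_map_mem (p := p) (g := g) hπ hker
  obtain ⟨hK, hsoc⟩ := hT (fun i => π (g i)) (fun i => hhom _ _ (hg i)) (fun i => by
    obtain ⟨j, hj⟩ := hX i
    obtain ⟨k, hk⟩ := hrad j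
    refine ⟨k, ?_⟩
    rw [← hj, ← map_pow]
    exact (hmem _).mp hk)
  refine ⟨SyzygiesKoszul.of_quotient hc hπ hker hg hK, fun b hb =>
    mem_span_of_mul_mem_span (linearForm_ne_zero hc) hπ hker isUnit_two hK hb,
    fun m h hh hm hXh => (hmem h).mpr (hsoc m _ (hhom _ _ hh) hm fun i => ?_)⟩
  obtain ⟨j, hj⟩ := hX i
  rw [← hj, ← map_mul]
  exact (hmem _).mp (hXh j)

/-- Induction on the number of variables. The ideal I of the forms other than q = g 0 has finitely
many zeros, so a linear form ℓ avoids them and the induction hypothesis applies modulo ℓ. A power of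
ℓ lies in I + (q) and ℓ is a nonzerodivisor modulo I, hence so is q, which makes the syzygies
Koszul. For the socle, a relation ℓ h ≡ q u modulo I trades h, in the socle modulo q, for u, in the
socle modulo ℓ. -/
theorem hasKoszulSyzygiesAndSocle [CharZero K] (e : ℕ) :
    ∀ n : ℕ, HasKoszulSyzygiesAndSocle K e n := by
  intro n
  induction n with
  | zero =>
    intro g _ _
    exact ⟨fun a _ => ⟨0, by simp, Subsingleton.elim _ _⟩, fun m h _ hm => by simp at hm⟩
  | succ n ih =>
    intro g hg hrad
    have hspan : Ideal.span (Set.range g) =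
        Ideal.span (Set.range (Fin.tail g)) ⊔ Ideal.span {g 0} := by
      rw [← Ideal.span_union, Set.union_singleton, Fin.range_fin_succ]
    have hg' : ∀ i, (Fin.tail g i).IsHomogeneous (e + 1) := fun i => hg i.succ
    rw [hspan] at hrad ⊢
    obtain ⟨c, hc, hcrad⟩ := exists_linearForm_of_projDimLEZero (isHomogeneous_span_range hg')
      (projDimLEZero_of_radical ((hg 0).mem_idealOfVars e.succ_ne_zero) hrad)
    obtain ⟨hK, hℓ, hsoc⟩ := ih.of_linearForm hg' hc hcrad
    set I := Ideal.span (Set.range (Fin.tail g)) with hI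
    have hℓrad : linearForm c ∈ (I ⊔ Ideal.span {g 0}).radical :=
      (idealOfVars_le_iff.mpr hrad)
        ((isHomogeneous_linearForm c).mem_idealOfVars one_ne_zero)
    have hq : ∀ b, g 0 * b ∈ I → b ∈ I := fun b hb =>
      mem_of_mul_mem_of_mem_radical hℓ hℓrad hb
    constructor
    · intro a ha
      have ha' : a 0 * g 0 + Fin.tail a ⬝ᵥ Fin.tail g = 0 := by
        rw [← ha, dotProduct, dotProduct, Fin.sum_univ_succ]
        rfl
      have := hK.isKoszul_cons ha' (hq _ (by
        rw [mul_comm, eq_neg_of_add_eq_zero_left ha']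
        exact I.neg_mem (dotProduct_mem_span _ _)))
      rwa [Fin.cons_self_tail, Fin.cons_self_tail] at this
    · intro m h hh hm hXh
      have hℓh : linearForm c * h ∈ I ⊔ Ideal.span {g 0} := by
        rw [linearForm, Finset.sum_mul]
        refine Ideal.sum_mem _ fun i _ => ?_
        rw [mul_assoc]
        exact Ideal.mul_mem_left _ _ (hXh i)
      obtain ⟨y, hy, z, hz, hyz⟩ := Submodule.mem_sup.mp hℓh
      obtain ⟨u, rfl⟩ := Ideal.mem_span_singleton'.mp hz
      have hy' : homogeneousComponent (m + 1) y ∈ I :=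
        homogeneousComponent_mem_of_mem (isHomogeneous_span_range hg') hy _
      have hcomp := congrArg (homogeneousComponent (m + 1)) hyz
      rw [map_add, homogeneousComponent_mul_of_isHomogeneous (hg 0), mul_comm (linearForm c),
        homogeneousComponent_eq_self (hh.mul (isHomogeneous_linearForm c))] at hcomp
      by_cases hme : e + 1 ≤ m + 1
      · rw [if_pos hme] at hcomp
        -- The degree of u is m - e, which is below n e because m < (n + 1) e.
        refine mem_sup_span_of_socle (u := homogeneousComponent (m + 1 - (e + 1)) u) hℓ hq hXh ?_
          (hsoc _ _ (homogeneousComponent_isHomogeneous _ _) ?_)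
        · convert hy' using 1
          linear_combination -hcomp
        · rw [Nat.succ_mul] at hm
          omega
      · rw [if_neg hme, add_zero] at hcomp
        refine le_sup_left (a := I) (hℓ h ?_)
        rw [mul_comm, ← hcomp]
        exact hy'

/-- In a graded ideal with generators whose zero set is finite, `n` general linear combinations of
the `n + 1` generators still have a finite projective zero set. -/
theorem exists_generic_linearCombinations [Infinite K] {d : ℕ}
    {f : Fin (n + 1) → MvPolynomial (Fin (n + 1)) K} (hf : ∀ i, (f i).IsHomogeneous d)
    (h : ProjDimLEZero (Ideal.span (Set.range f))) :
    ∃ A : Matrix (Fin (n + 1)) (Fin (n + 1)) K, IsUnit A ∧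
      ProjDimLEZero (Ideal.span (Set.range fun j : Fin n => (A.map C).mulVec f j.succ)) := by
  set L := Fintype.linearCombination K f with hL
  have hLhom : ∀ c, (L c).IsHomogeneous d := fun c => by
    rw [hL, Fintype.linearCombination_apply]
    refine IsHomogeneous.sum _ _ _ fun i _ => ?_
    rw [smul_eq_C_mul]
    exact (hf i).C_mul _
  have hstep : ∀ {i : ℕ} (c : Fin i → Fin (n + 1) → K), i ≤ n → LinearIndependent K c →
      Submodule.span K (Set.range c) ≠ ⊤ := by
    intro i c hi hc htop
    have h1 := finrank_span_eq_card hc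
    rw [htop, finrank_top] at h1
    simp at h1
    omega
  -- Each further general combination raises by one the height of the primes that contain the chosen
  -- combinations but not all of f: it avoids the minimal primes of the previous ideal that do not
  -- contain all of f.
  have main : ∀ i, i ≤ n → ∃ c : Fin i → Fin (n + 1) → K, LinearIndependent K c ∧
      ∀ P : Ideal (MvPolynomial (Fin (n + 1)) K), P.IsPrime →
        P.IsHomogeneous (homogeneousSubmodule (Fin (n + 1)) K) → (∀ j, L (c j) ∈ P) →
        (∃ k, f k ∉ P) → (i : ℕ∞) ≤ P.height := by
    intro i
    induction i with
    | zero => exact fun _ => ⟨Fin.elim0, linearIndependent_empty_type, by simp⟩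
    | succ i ih =>
      intro hi
      obtain ⟨c, hc, hP⟩ := ih (by omega)
      set I := Ideal.span (Set.range fun j => L (c j)) with hI
      have hIhom := isHomogeneous_span_range fun j => hLhom (c j)
      obtain ⟨x, hx, hxP⟩ := exists_notMem_of_finite L
        (T := {P ∈ I.minimalPrimes | ∃ k, f k ∉ P})
        ((I.finite_minimalPrimes_of_isNoetherianRing).subset (Set.sep_subset _ _))
        (fun P hP => by
          classical
          obtain ⟨k, hk⟩ := hP.2
          exact ⟨Pi.single k 1, by simpa [hL] using hk⟩)
        (hstep c (by omega) hc)
      refine ⟨Fin.cons x c, linearIndependent_finCons.mpr ⟨hc, hx⟩, ?_⟩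
      intro P hPp hPh hLP hfP
      have hIP : I ≤ P := by
        rw [hI, Ideal.span_le]
        rintro _ ⟨j, rfl⟩
        simpa using hLP j.succ
      obtain ⟨P', hP', hP'P⟩ := Ideal.exists_minimalPrimes_le hIP
      have hfP' : ∃ k, f k ∉ P' := hfP.imp fun k hk hk' => hk (hP'P hk')
      have hlt : P' < P := lt_of_le_of_ne hP'P (by
        rintro rfl
        exact hxP P' ⟨hP', hfP'⟩ (by simpa using hLP 0))
      have hP'p := hP'.1.1
      have h1 := hP P' hP'p (isHomogeneous_of_mem_minimalPrimes hIhom hP')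
        (fun j => hP'.1.2 (Ideal.subset_span ⟨j, rfl⟩)) hfP'
      calc ((i + 1 : ℕ) : ℕ∞) = i + 1 := by push_cast; rfl
        _ ≤ P'.height + 1 := by gcongr
        _ ≤ P.height := Ideal.height_add_one_le_of_lt_of_isPrime hlt
  obtain ⟨c, hc, hP⟩ := main n le_rfl
  obtain ⟨x, -, hx⟩ := SetLike.exists_of_lt (lt_top_iff_ne_top.mpr (hstep c le_rfl hc))
  refine ⟨Matrix.of (Fin.cons x c), ?_, ?_⟩
  · rw [← Matrix.linearIndependent_rows_iff_isUnit]
    exact linearIndependent_finCons.mpr ⟨hc, hx⟩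
  · have hLA : ∀ j : Fin n, ((Matrix.of (Fin.cons x c)).map C).mulVec f j.succ = L (c j) := by
      intro j
      simp [Matrix.mulVec, dotProduct, hL, Fintype.linearCombination_apply, smul_eq_C_mul]
    simp only [hLA]
    intro P Q hPp hQp hPh hQh hIP hPQ
    by_cases hfP : ∃ k, f k ∉ P
    · have h1 := hP P hPp hPh (fun j => hIP (Ideal.subset_span ⟨j, rfl⟩)) hfP
      rw [← idealOfVars_le_iff]
      -- The height of P is at least n, so a chain from P through Q to the ideal of the variables
      -- would give the latter height at least n + 2, in a ring of dimension n + 1.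
      by_contra hcon
      have hlt : Q < idealOfVars (Fin (n + 1)) K :=
        lt_of_le_not_ge (le_span_X_of_isHomogeneous hQh hQp.ne_top) hcon
      have hprime := isPrime_idealOfVars (K := K) (σ := Fin (n + 1))
      have h2 := Ideal.height_add_one_le_of_lt_of_isPrime hPQ
      have h3 := Ideal.height_add_one_le_of_lt_of_isPrime hlt
      have h4 := Ideal.height_le_ringKrullDim_of_ne_top hprime.ne_top
      rw [MvPolynomial.ringKrullDim_of_isNoetherianRing, ringKrullDim_eq_zero_of_field, zero_add,
        Nat.card_eq_fintype_card, Fintype.card_fin] at h4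
      have h5 : (idealOfVars (Fin (n + 1)) K).height ≤ ((n + 1 : ℕ) : ℕ∞) := by exact_mod_cast h4
      have h6 : ((n + 2 : ℕ) : ℕ∞) ≤ (idealOfVars (Fin (n + 1)) K).height := by
        calc ((n + 2 : ℕ) : ℕ∞) = (n : ℕ∞) + 1 + 1 := by push_cast; rw [add_assoc]; rfl
          _ ≤ P.height + 1 + 1 := by gcongr
          _ ≤ Q.height + 1 := by gcongr
          _ ≤ _ := h3
      have h7 := h6.trans h5
      rw [Nat.cast_le] at h7
      omega
    · push Not at hfP
      refine h P Q hPp hQp hPh hQh ?_ hPQ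
      rw [Ideal.span_le]
      rintro _ ⟨k, rfl⟩
      exact hfP k

end MvPolynomial

/-! ### Ideals of points and the Nullstellensatz -/

namespace MvPolynomial

variable {K : Type*} [Field K] {n : ℕ}

attribute [local instance] MvPolynomial.gradedAlgebra

theorem IsHomogeneous.aeval_mul {σ A : Type*} [CommRing A] [Algebra K A] {q : MvPolynomial σ K}
    {k : ℕ} (hq : q.IsHomogeneous k) (t : A) (y : σ → A) :
    MvPolynomial.aeval (fun i => t * y i) q = t ^ k * MvPolynomial.aeval y q := by
  rw [aeval_def, aeval_def, eval₂_eq, eval₂_eq, Finset.mul_sum]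
  refine Finset.sum_congr rfl fun m hm => ?_
  have hk : ∑ i ∈ m.support, m i = k := (hq.degree_eq_sum_deg_support hm).symm
  simp only [mul_pow, Finset.prod_mul_distrib, Finset.prod_pow_eq_pow_sum, hk]
  ring

theorem IsHomogeneous.eval_smul {σ : Type*} {q : MvPolynomial σ K} {k : ℕ}
    (hq : q.IsHomogeneous k) (t : K) (x : σ → K) : eval (t • x) q = t ^ k * eval x q := by
  have : t • x = fun i => t * x i := rfl
  rw [this]
  simpa [aeval_eq_eval] using hq.aeval_mul t x

/-- The ideal generated by the linear forms that vanish at `v`. -/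
noncomputable def lineIdeal (v : Fin n → K) : Ideal (MvPolynomial (Fin n) K) :=
  Ideal.span {p | ∃ c, c ⬝ᵥ v = 0 ∧ p = linearForm c}

theorem linearForm_mem_lineIdeal {c v : Fin n → K} (h : c ⬝ᵥ v = 0) :
    linearForm c ∈ lineIdeal v := Ideal.subset_span ⟨c, h, rfl⟩

theorem lineIdeal_smul {t : K} (ht : t ≠ 0) (v : Fin n → K) : lineIdeal (t • v) = lineIdeal v := by
  simp [lineIdeal, dotProduct_smul, ht]

theorem eval_eq_zero_of_mem_lineIdeal {p : MvPolynomial (Fin n) K} {v : Fin n → K}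
    (hp : p ∈ lineIdeal v) : eval v p = 0 := by
  have : lineIdeal v ≤ RingHom.ker (eval v) := by
    rw [lineIdeal, Ideal.span_le]
    rintro _ ⟨c, hc, rfl⟩
    simpa using hc
  exact this hp

theorem X_sub_mem_lineIdeal {c v : Fin n → K} (h : c ⬝ᵥ v = 1) (i : Fin n) :
    X i - C (v i) * linearForm c ∈ lineIdeal v := by
  classical
  have : X i - C (v i) * linearForm c = linearForm (Pi.single i 1 - v i • c) := by
    simp only [← linearCombination_X, map_sub, map_smul, smul_eq_C_mul]
    simp
  rw [this]
  exact linearForm_mem_lineIdeal (by simp [sub_dotProduct, h])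

/-- Modulo the ideal of the line, X i equals v i times the linear form c, so a form of degree k is
determined by its value at v. -/
theorem IsHomogeneous.sub_mem_lineIdeal {q : MvPolynomial (Fin n) K} {k : ℕ}
    (hq : q.IsHomogeneous k) {c v : Fin n → K} (h : c ⬝ᵥ v = 1) :
    q - C (eval v q) * linearForm c ^ k ∈ lineIdeal v := by
  have key : (Ideal.Quotient.mkₐ K (lineIdeal v)).comp
      (MvPolynomial.aeval fun i => linearForm c * C (v i)) =
      Ideal.Quotient.mkₐ K (lineIdeal v) := by
    ext i
    simp only [AlgHom.comp_apply, aeval_X, Ideal.Quotient.mkₐ_eq_mk]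
    refine (Ideal.Quotient.eq.mpr ?_).symm
    rw [mul_comm]
    exact X_sub_mem_lineIdeal h i
  have h1 := DFunLike.congr_fun key q
  rw [AlgHom.comp_apply, hq.aeval_mul] at h1
  have h2 : MvPolynomial.aeval (fun i => (C (v i) : MvPolynomial (Fin n) K)) q = C (eval v q) := by
    have : (MvPolynomial.aeval fun i => (C (v i) : MvPolynomial (Fin n) K)) =
        (Algebra.ofId K (MvPolynomial (Fin n) K)).comp (MvPolynomial.aeval v) := by
      ext1 i
      simp [Algebra.ofId_apply, algebraMap_eq]
    rw [this]
    simp [Algebra.ofId_apply, algebraMap_eq, aeval_eq_eval]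
  rw [h2, mul_comm] at h1
  exact Ideal.Quotient.eq.mp h1.symm

theorem exists_dotProduct_eq_one {v : Fin n → K} (hv : v ≠ 0) : ∃ c : Fin n → K, c ⬝ᵥ v = 1 := by
  classical
  obtain ⟨i, hi⟩ := Function.ne_iff.mp hv
  exact ⟨Pi.single i (v i)⁻¹, by simpa using inv_mul_cancel₀ hi⟩

theorem idealOfVars_le_lineIdeal_sup {c v : Fin n → K} (h : c ⬝ᵥ v ≠ 0) :
    idealOfVars (Fin n) K ≤ lineIdeal v ⊔ Ideal.span {linearForm c} := by
  rw [idealOfVars_le_iff]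
  intro i
  have h1 : ((c ⬝ᵥ v)⁻¹ • c) ⬝ᵥ v = 1 := by
    rw [smul_dotProduct, smul_eq_mul, inv_mul_cancel₀ h]
  have h2 := X_sub_mem_lineIdeal h1 i
  refine Submodule.mem_sup.mpr ⟨_, h2, C (v i) * linearForm ((c ⬝ᵥ v)⁻¹ • c), ?_, by ring⟩
  rw [← linearCombination_X ((c ⬝ᵥ v)⁻¹ • c), map_smul, linearCombination_X, smul_eq_C_mul]
  exact Ideal.mul_mem_left _ _ (Ideal.mul_mem_left _ _ (Ideal.mem_span_singleton_self _))

/-- A linear form separating two points of a projective space. -/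
theorem exists_linearForm_separating {v w : Fin n → K} (hv : v ≠ 0) (hw : w ≠ 0)
    (h : Projectivization.mk K v hv ≠ Projectivization.mk K w hw) :
    ∃ c : Fin n → K, c ⬝ᵥ w = 0 ∧ c ⬝ᵥ v ≠ 0 := by
  classical
  by_contra! hcon
  obtain ⟨i, hi⟩ := Function.ne_iff.mp hw
  apply h
  rw [Projectivization.mk_eq_mk_iff']
  refine ⟨v i / w i, ?_⟩
  ext j
  have := hcon (w j • Pi.single i 1 - w i • Pi.single j 1) (by simp [sub_dotProduct]; ring)
  simp [sub_dotProduct] at this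
  simp only [Pi.zero_apply, ne_eq] at hi
  simp only [Pi.smul_apply, smul_eq_mul]
  field_simp
  linear_combination this

section Nullstellensatz

variable [IsAlgClosed K]

theorem mem_radical_of_forall_eval {J : Ideal (MvPolynomial (Fin n) K)} {q : MvPolynomial (Fin n) K}
    (h : ∀ x, (∀ p ∈ J, eval x p = 0) → eval x q = 0) : q ∈ J.radical := by
  rw [← vanishingIdeal_zeroLocus_eq_radical (K := K), mem_vanishingIdeal_iff]
  intro x hx
  rw [mem_zeroLocus_iff] at hx
  simpa [aeval_eq_eval] using h x fun p hp => by simpa [aeval_eq_eval] using hx p hp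

/-- An ideal without common zeros other than the origin contains a power of each variable. -/
theorem idealOfVars_le_radical {J : Ideal (MvPolynomial (Fin n) K)}
    (h : ∀ x ≠ 0, ∃ p ∈ J, eval x p ≠ 0) : idealOfVars (Fin n) K ≤ J.radical := by
  rw [idealOfVars_le_iff]
  intro i
  refine mem_radical_of_forall_eval fun x hx => ?_
  by_cases h0 : x = 0
  · simp [h0]
  · obtain ⟨p, hp, hpx⟩ := h x h0
    exact absurd (hx p hp) hpx

variable {J : Ideal (MvPolynomial (Fin n) K)} {Z : Finset (ℙ K (Fin n → K))}

/-- The factor `idealOfVars` accounts for the origin, which the product alone would miss when Z is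
empty. -/
theorem idealOfVars_mul_prod_le_radical
    (hZ : ∀ x (hx : x ≠ 0), (∀ p ∈ J, eval x p = 0) → Projectivization.mk K x hx ∈ Z) :
    idealOfVars (Fin n) K * ∏ p ∈ Z, lineIdeal p.rep ≤ J.radical := by
  classical
  intro q hq
  refine mem_radical_of_forall_eval fun x hx => ?_
  by_cases h0 : x = 0
  · have := Ideal.mul_le_left hq
    rw [idealOfVars_eq_ker, RingHom.mem_ker] at this
    rwa [h0, eval_zero]
  · have h2 : q ∈ lineIdeal (Projectivization.mk K x h0).rep :=
      Ideal.mul_le_right.trans (Ideal.prod_le_inf.trans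
        (Finset.inf_le (f := fun p : ℙ K (Fin n → K) => lineIdeal p.rep) (hZ x h0 hx))) hq
    obtain ⟨a, ha⟩ := Projectivization.exists_smul_eq_mk_rep K x h0
    rw [← ha, Units.smul_def, lineIdeal_smul a.ne_zero] at h2
    exact eval_eq_zero_of_mem_lineIdeal h2

/-- A prime P over J contains either all variables or the ideal of some point p in Z. In the second
case, modulo that ideal every form is a scalar times a power of a linear form ℓ with ℓ(p) = 1. So a
homogeneous prime strictly above P contains ℓ and with it all variables. -/
theorem projDimLEZero_of_finite
    (hZ : ∀ x (hx : x ≠ 0), (∀ p ∈ J, eval x p = 0) → Projectivization.mk K x hx ∈ Z) :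
    ProjDimLEZero J := by
  intro P Q hP hQ hPh hQh hJP hPQ
  rw [← idealOfVars_le_iff]
  have h1 := (idealOfVars_mul_prod_le_radical hZ).trans (hP.radical_le_iff.mpr hJP)
  rcases hP.mul_le.mp h1 with h2 | h2
  · exact h2.trans hPQ.le
  · obtain ⟨p, -, hp⟩ := (hP.prod_le).mp h2
    obtain ⟨q, hqQ, hqP⟩ := SetLike.exists_of_lt hPQ
    have : ∃ k, homogeneousComponent k q ∉ P := by
      by_contra! hcon
      apply hqP
      rw [← sum_homogeneousComponent q]
      exact P.sum_mem fun k _ => hcon k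
    obtain ⟨k, hk⟩ := this
    have hkQ : homogeneousComponent k q ∈ Q := homogeneousComponent_mem_of_mem hQh hqQ k
    obtain ⟨c, hc⟩ := exists_dotProduct_eq_one p.rep_nonzero
    have h3 := (homogeneousComponent_isHomogeneous k q).sub_mem_lineIdeal hc
    have h4 : eval p.rep (homogeneousComponent k q) ≠ 0 := by
      intro h0
      rw [h0, C_0, zero_mul, sub_zero] at h3
      exact hk (hp h3)
    have h5 : C (eval p.rep (homogeneousComponent k q)) * linearForm c ^ k ∈ Q := by
      have := Q.sub_mem hkQ (hPQ.le (hp h3))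
      simpa using this
    have h6 : linearForm c ^ k ∈ Q := by
      rwa [Ideal.unit_mul_mem_iff_mem _ ((IsUnit.mk0 _ h4).map C)] at h5
    have h7 := hQ.mem_of_pow_mem k h6
    refine (idealOfVars_le_lineIdeal_sup (c := c) (v := p.rep) (by rw [hc]; exact one_ne_zero)).trans
      (sup_le (hp.trans hPQ.le) ?_)
    rwa [Ideal.span_singleton_le_iff_mem]

/-- Near each of the finitely many points of its zero set, `J` contains a power of the ideal of
that point. -/
theorem exists_mul_pow_lineIdeal_le
    (hZ : ∀ x (hx : x ≠ 0), (∀ p ∈ J, eval x p = 0) → Projectivization.mk K x hx ∈ Z)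
    {v : Fin n → K} (hv : v ≠ 0) :
    ∃ (s : MvPolynomial (Fin n) K) (b : ℕ), eval v s ≠ 0 ∧
      ∀ F ∈ lineIdeal v ^ b, s * F ∈ J := by
  classical
  have hsep : ∀ p : ℙ K (Fin n → K), ∃ c : Fin n → K,
      p ≠ Projectivization.mk K v hv → c ⬝ᵥ p.rep = 0 ∧ c ⬝ᵥ v ≠ 0 := by
    intro p
    by_cases hp : p = Projectivization.mk K v hv
    · exact ⟨0, fun h => absurd hp h⟩
    · obtain ⟨c, hc⟩ := exists_linearForm_separating hv p.rep_nonzero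
        (by rw [Projectivization.mk_rep]; exact Ne.symm hp)
      exact ⟨c, fun _ => hc⟩
  choose c hc using hsep
  obtain ⟨i, hi⟩ := Function.ne_iff.mp hv
  let p₀ := Projectivization.mk K v hv
  -- One linear form for each other point of Z, vanishing there but not at v; the factor X i
  -- vanishes at the origin.
  let s : MvPolynomial (Fin n) K := X i * ∏ p ∈ Z.erase p₀, linearForm (c p)
  have hs : eval v s ≠ 0 := by
    simp only [s, map_mul, eval_X, map_prod, eval_linearForm]
    exact mul_ne_zero hi (Finset.prod_ne_zero_iff.mpr fun p hp => (hc p (Finset.ne_of_mem_erase hp)).2)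
  have hle : Ideal.span {s} * lineIdeal v ≤ J.radical := by
    rw [Ideal.mul_le]
    intro x hx F hF
    obtain ⟨y, rfl⟩ := Ideal.mem_span_singleton'.mp hx
    rw [mul_assoc]
    refine Ideal.mul_mem_left _ _ (mem_radical_of_forall_eval fun x hx => ?_)
    by_cases h0 : x = 0
    · simp [s, h0]
    · by_cases hp : Projectivization.mk K x h0 = p₀
      · obtain ⟨a, ha⟩ := (Projectivization.mk_eq_mk_iff' K x v h0 hv).mp hp
        have ha0 : a ≠ 0 := by rintro rfl; exact h0 (by rw [← ha, zero_smul])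
        rw [← ha, map_mul, eval_eq_zero_of_mem_lineIdeal (p := F) (by rwa [lineIdeal_smul ha0]), mul_zero]
      · obtain ⟨a, ha⟩ := Projectivization.exists_smul_eq_mk_rep K x h0
        have h1 := (hc _ hp).1
        rw [← ha, Units.smul_def, dotProduct_smul, smul_eq_zero] at h1
        have h2 := h1.resolve_left a.ne_zero
        have h3 : ∏ p ∈ Z.erase p₀, c p ⬝ᵥ x = 0 :=
          Finset.prod_eq_zero (Finset.mem_erase.mpr ⟨hp, hZ x h0 hx⟩) h2
        simp [s, map_prod, h3]
  obtain ⟨b, hb⟩ := Ideal.exists_pow_le_of_le_radical_of_fg hle (IsNoetherian.noetherian _)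
  refine ⟨s ^ b, b, by rw [map_pow]; exact pow_ne_zero b hs, fun F hF => hb ?_⟩
  rw [mul_pow]
  exact Ideal.mul_mem_mul (Ideal.pow_mem_pow (Ideal.mem_span_singleton_self s) b) hF

end Nullstellensatz

end MvPolynomial

/-! ### Hadamard's lemma and the maximal ideal of the ring of germs -/

/-- Hadamard's lemma: an analytic function that vanishes at the origin is, near the origin, the
value of an analytic family of linear forms. -/
theorem AnalyticAt.exists_eq_apply {E : Type*} [NormedAddCommGroup E] [NormedSpace ℂ E]
    {F : E → ℂ} (hF : AnalyticAt ℂ F 0) (h0 : F 0 = 0) :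
    ∃ G : E → (E →L[ℂ] ℂ), AnalyticAt ℂ G 0 ∧ ∀ᶠ z in 𝓝 0, F z = G z z := by
  obtain ⟨p, r, hp⟩ := hF
  have hrad : 0 < p.shift.radius := by
    rw [FormalMultilinearSeries.radius_shift]
    exact hp.radius_pos
  have hq := p.shift.hasFPowerSeriesOnBall hrad
  -- Shifting the power series drops the constant term, which is zero, and leaves the last argument
  -- of each remaining term free; feeding z to it gives F back.
  refine ⟨p.shift.sum, hq.analyticAt, ?_⟩
  filter_upwards [hp.eventually_hasSum, hq.eventually_hasSum] with z h1 h2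
  rw [zero_add] at h1 h2
  have h3 := h2.mapL (ContinuousLinearMap.apply ℂ ℂ z)
  have h4 := (hasSum_nat_add_iff' 1).mpr h1
  simp only [Finset.range_one, Finset.sum_singleton] at h4
  have h5 : p 0 (fun _ => z) = 0 := by
    rw [hp.coeff_zero, h0]
  rw [h5, sub_zero] at h4
  refine h4.unique ?_
  rw [ContinuousLinearMap.apply_apply] at h3
  convert h3 using 2 with k
  simp only [FormalMultilinearSeries.shift, ContinuousLinearMap.apply_apply,
    ContinuousMultilinearMap.curryRight_apply]
  congr 1
  ext i
  refine Fin.lastCases ?_ (fun i => ?_) i <;> simp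

namespace HolGerm

variable {n : ℕ}

theorem exists_mk (γ : HolGerm n) : ∃ F hF, γ = mk F hF := by
  obtain ⟨_, F, hF, rfl⟩ := γ
  exact ⟨F, hF, rfl⟩

theorem mk_eq_mk {F G : (Fin n → ℂ) → ℂ} (hF : AnalyticAt ℂ F 0) (hG : AnalyticAt ℂ G 0) :
    mk F hF = mk G hG ↔ F =ᶠ[𝓝 0] G := by
  rw [Subtype.ext_iff]
  exact Filter.Germ.coe_eq

theorem mk_mul_mk {F G : (Fin n → ℂ) → ℂ} (hF : AnalyticAt ℂ F 0) (hG : AnalyticAt ℂ G 0) :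
    mk F hF * mk G hG = mk (fun z => F z * G z) (hF.mul hG) := rfl

theorem mk_add_mk {F G : (Fin n → ℂ) → ℂ} (hF : AnalyticAt ℂ F 0) (hG : AnalyticAt ℂ G 0) :
    mk F hF + mk G hG = mk (fun z => F z + G z) (hF.add hG) := rfl

theorem one_eq_mk : (1 : HolGerm n) = mk (fun _ => 1) analyticAt_const := rfl

theorem zero_eq_mk : (0 : HolGerm n) = mk (fun _ => 0) analyticAt_const := rfl

@[simp] theorem valueHom_mk {F : (Fin n → ℂ) → ℂ} (hF : AnalyticAt ℂ F 0) :
    valueHom n (mk F hF) = F 0 := rfl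

theorem mem_maxIdeal {γ : HolGerm n} : γ ∈ maxIdeal n ↔ valueHom n γ = 0 := RingHom.mem_ker

theorem isUnit_of_valueHom_ne_zero {γ : HolGerm n} (h : valueHom n γ ≠ 0) : IsUnit γ := by
  obtain ⟨F, hF, rfl⟩ := exists_mk γ
  rw [valueHom_mk] at h
  refine IsUnit.of_mul_eq_one (mk (fun z => (F z)⁻¹) (hF.inv h)) ?_
  rw [mk_mul_mk, one_eq_mk, mk_eq_mk]
  filter_upwards [hF.continuousAt.eventually_ne h] with z hz
  exact mul_inv_cancel₀ hz

/-- A germ with nonzero value at the origin is invertible. This makes Nakayama's lemma available. -/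
theorem maxIdeal_le_jacobson : maxIdeal n ≤ (⊥ : Ideal (HolGerm n)).jacobson := by
  intro γ hγ
  rw [Ideal.mem_jacobson_bot]
  intro y
  refine isUnit_of_valueHom_ne_zero ?_
  rw [map_add, map_mul, mem_maxIdeal.mp hγ]
  simp

/-- The constant germs. -/
noncomputable def const (n : ℕ) : ℂ →+* HolGerm n where
  toFun c := mk (fun _ => c) analyticAt_const
  map_one' := rfl
  map_mul' _ _ := rfl
  map_zero' := rfl
  map_add' _ _ := rfl

theorem const_apply (c : ℂ) : const n c = mk (fun _ => c) analyticAt_const := rfl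

@[simp] theorem valueHom_const (c : ℂ) : valueHom n (const n c) = c := rfl

noncomputable instance : Algebra ℂ (HolGerm n) := (const n).toAlgebra

theorem algebraMap_eq_const : algebraMap ℂ (HolGerm n) = const n := rfl

theorem analyticAt_eval_pi (i : Fin n) : AnalyticAt ℂ (fun z : Fin n → ℂ => z i) 0 :=
  (ContinuousLinearMap.proj (R := ℂ) (φ := fun _ : Fin n => ℂ) i).analyticAt 0

/-- The coordinate germs. -/
noncomputable def coord (i : Fin n) : HolGerm n := mk (fun z => z i) (analyticAt_eval_pi i)

theorem sum_mk {ι : Type*} (s : Finset ι) (F : ι → (Fin n → ℂ) → ℂ)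
    (hF : ∀ i, AnalyticAt ℂ (F i) 0) :
    ∑ i ∈ s, mk (F i) (hF i) =
      mk (fun z => ∑ i ∈ s, F i z) (Finset.analyticAt_fun_sum s fun i _ => hF i) := by
  classical
  induction s using Finset.induction_on with
  | empty => rfl
  | insert i s hi ih =>
    rw [Finset.sum_insert hi, ih, mk_add_mk, mk_eq_mk]
    exact Filter.Eventually.of_forall fun z => by simp [Finset.sum_insert hi]

/-- A germ vanishing at the origin is a combination of the coordinates, whose coefficients have the
partial derivatives as values at the origin. -/
theorem exists_eq_sum_coord {γ : HolGerm n} (h : γ ∈ maxIdeal n) :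
    ∃ c : Fin n → HolGerm n, γ = ∑ i, c i * coord i ∧
      ∀ i, valueHom n (c i) = valueHom n (partialDeriv i γ) := by
  obtain ⟨F, hF, rfl⟩ := exists_mk γ
  have h0 : F 0 = 0 := mem_maxIdeal.mp h
  obtain ⟨G, hG, hFG⟩ := hF.exists_eq_apply h0
  have hGi : ∀ i : Fin n, AnalyticAt ℂ (fun z => G z (Pi.single i 1)) 0 := fun i =>
    ((ContinuousLinearMap.apply ℂ ℂ (Pi.single i (1 : ℂ) : Fin n → ℂ)).analyticAt _).comp hG
  have hsum : mk F hF = ∑ i, mk (fun z => G z (Pi.single i 1)) (hGi i) * coord i := by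
    change _ = ∑ i, mk (fun z => G z (Pi.single i 1) * z i) ((hGi i).mul (analyticAt_eval_pi i))
    rw [sum_mk, mk_eq_mk]
    filter_upwards [hFG] with z hz
    have hlin : ∀ L : (Fin n → ℂ) →L[ℂ] ℂ, L z = ∑ i, L (Pi.single i 1) * z i := fun L => by
      conv_lhs => rw [pi_eq_sum_univ' z]
      simp [mul_comm]
    rw [hz, hlin]
  refine ⟨_, hsum, fun i => ?_⟩
  have hder : HasFDerivAt F (G 0) 0 := by
    have := hG.differentiableAt.hasFDerivAt.clm_apply (hasFDerivAt_id (𝕜 := ℂ) (0 : Fin n → ℂ))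
    refine HasFDerivAt.congr_of_eventuallyEq (this.congr_fderiv ?_) hFG
    ext v
    simp
  rw [valueHom_mk]
  change _ = fderiv ℂ F 0 (Pi.single i 1)
  rw [hder.fderiv]

theorem maxIdeal_eq_span_coord : maxIdeal n = Ideal.span (Set.range coord) := by
  apply le_antisymm
  · intro γ hγ
    obtain ⟨c, rfl, -⟩ := exists_eq_sum_coord hγ
    exact Ideal.sum_mem _ fun i _ => Ideal.mul_mem_left _ _ (Ideal.subset_span ⟨i, rfl⟩)
  · rw [Ideal.span_le]
    rintro _ ⟨i, rfl⟩
    exact mem_maxIdeal.mpr rfl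

/-- Germs with the partial derivatives of the coordinates at the origin generate the maximal
ideal. -/
theorem maxIdeal_eq_span_of_partialDeriv {w : Fin n → HolGerm n} (hw : ∀ i, w i ∈ maxIdeal n)
    (hd : ∀ i j, valueHom n (partialDeriv j (w i)) = if i = j then 1 else 0) :
    maxIdeal n = Ideal.span (Set.range w) := by
  apply le_antisymm
  · have hfg : (maxIdeal n).FG := by
      rw [maxIdeal_eq_span_coord]
      exact Submodule.fg_span (Set.finite_range _)
    -- Nakayama: each coordinate differs from w i by an element of the square of the maximal ideal,
    -- since their first derivatives at the origin agree.
    refine Submodule.le_of_le_smul_of_le_jacobson_bot hfg maxIdeal_le_jacobson ?_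
    conv_lhs => rw [maxIdeal_eq_span_coord]
    rw [Ideal.span_le]
    rintro _ ⟨i, rfl⟩
    obtain ⟨c, hc, hcv⟩ := exists_eq_sum_coord (hw i)
    have h1 : coord i = w i + ∑ j, ((if i = j then 1 else 0) - c j) * coord j := by
      simp [sub_mul, Finset.sum_sub_distrib, ← hc]
    rw [h1]
    refine Submodule.add_mem_sup (Ideal.subset_span ⟨i, rfl⟩) (Ideal.sum_mem _ fun j _ => ?_)
    rw [smul_eq_mul]
    refine Ideal.mul_mem_mul ?_ (mem_maxIdeal.mpr rfl)
    rw [mem_maxIdeal, map_sub, hcv, hd, sub_eq_zero]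
    split_ifs <;> simp
  · rw [Ideal.span_le]
    rintro _ ⟨i, rfl⟩
    exact hw i

end HolGerm

/-! ### Orders of vanishing of polynomials and of germs -/

open Asymptotics in
/-- A polynomial that is `O(ε ^ b)` at the origin is divisible by `X ^ b`. -/
theorem Polynomial.X_pow_dvd_of_isBigO {b : ℕ} : ∀ {P : Polynomial ℂ},
    (fun ε : ℂ => P.eval ε) =O[𝓝[≠] 0] (fun ε => ε ^ b) → Polynomial.X ^ b ∣ P := by
  induction b with
  | zero => simp
  | succ b ih =>
    intro P hP
    have h0 : P.eval 0 = 0 := by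
      have h1 : Filter.Tendsto (fun ε : ℂ => ε ^ (b + 1)) (𝓝[≠] 0) (𝓝 0) := by
        have : Filter.Tendsto (fun ε : ℂ => ε ^ (b + 1)) (𝓝 0) (𝓝 (0 ^ (b + 1))) :=
          (continuous_pow (b + 1)).tendsto 0
        rw [zero_pow b.succ_ne_zero] at this
        exact this.mono_left nhdsWithin_le_nhds
      exact tendsto_nhds_unique (P.continuous.tendsto 0 |>.mono_left nhdsWithin_le_nhds)
        (hP.trans_tendsto h1)
    obtain ⟨Q, rfl⟩ : Polynomial.X ∣ P := Polynomial.X_dvd_iff.mpr (by rwa [Polynomial.coeff_zero_eq_eval_zero])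
    rw [pow_succ']
    refine mul_dvd_mul_left _ (ih ?_)
    have h2 : (fun ε : ℂ => ε * Q.eval ε) =O[𝓝[≠] 0] (fun ε => ε * ε ^ b) := by
      simpa [pow_succ'] using hP
    refine ((isBigO_refl (fun ε : ℂ => ε⁻¹) (𝓝[≠] 0)).mul h2).congr' ?_ ?_
    · filter_upwards [self_mem_nhdsWithin] with ε hε
      rw [inv_mul_cancel_left₀ hε]
    · filter_upwards [self_mem_nhdsWithin] with ε hε
      rw [inv_mul_cancel_left₀ hε]

namespace MvPolynomial

open Asymptotics

/-- A polynomial that is `O(‖y‖ ^ b)` at the origin has no terms of degree less than `b`. -/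
theorem mem_pow_idealOfVars_of_isBigO {n b : ℕ} {h : MvPolynomial (Fin n) ℂ}
    (hh : (fun y : Fin n → ℂ => eval y h) =O[𝓝 0] fun y => ‖y‖ ^ b) :
    h ∈ idealOfVars (Fin n) ℂ ^ b := by
  have key : ∀ k < b, homogeneousComponent k h = 0 := by
    intro k hk
    refine MvPolynomial.funext fun y => ?_
    -- The restriction of h to the line spanned by y; its coefficients are the values at y of the
    -- homogeneous components of h.
    set P : Polynomial ℂ := ∑ j ∈ Finset.range (h.totalDegree + 1),
      Polynomial.monomial j (eval y (homogeneousComponent j h)) with hP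
    have hPe : ∀ ε : ℂ, P.eval ε = eval (ε • y) h := by
      intro ε
      conv_rhs => rw [← sum_homogeneousComponent h, map_sum]
      rw [hP, Polynomial.eval_finsetSum]
      refine Finset.sum_congr rfl fun j _ => ?_
      rw [(homogeneousComponent_isHomogeneous j h).eval_smul, Polynomial.eval_monomial, mul_comm]
    have hdvd : Polynomial.X ^ b ∣ P := by
      apply Polynomial.X_pow_dvd_of_isBigO
      simp only [hPe]
      have ht : Filter.Tendsto (fun ε : ℂ => ε • y) (𝓝[≠] 0) (𝓝 0) := by
        have : Continuous fun ε : ℂ => ε • y := by fun_prop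
        simpa using (this.tendsto 0).mono_left nhdsWithin_le_nhds
      refine (hh.comp_tendsto ht).trans ?_
      refine IsBigO.of_bound (‖y‖ ^ b) (Filter.Eventually.of_forall fun ε => ?_)
      simp [norm_smul, mul_pow, mul_comm]
    have hcoeff := Polynomial.X_pow_dvd_iff.mp hdvd k hk
    rw [hP, Polynomial.finsetSum_coeff] at hcoeff
    simp only [Polynomial.coeff_monomial, Finset.sum_ite_eq', Finset.mem_range] at hcoeff
    split_ifs at hcoeff with hkd
    · simpa using hcoeff
    · rw [homogeneousComponent_eq_zero k h (by omega)]
  rw [mem_pow_idealOfVars_iff']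
  intro x hx
  have := congrArg (coeff x) (key _ hx)
  rwa [coeff_homogeneousComponent, if_pos rfl, coeff_zero] at this

end MvPolynomial

namespace HolGerm

open MvPolynomial Asymptotics

variable {n : ℕ}

theorem isBigO_of_mem_pow {b : ℕ} : ∀ {F : (Fin n → ℂ) → ℂ} {hF : AnalyticAt ℂ F 0},
    mk F hF ∈ maxIdeal n ^ b → F =O[𝓝 0] fun z => ‖z‖ ^ b := by
  have main : ∀ γ ∈ maxIdeal n ^ b, ∃ F hF, γ = mk F hF ∧ F =O[𝓝 0] fun z => ‖z‖ ^ b := by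
    induction b with
    | zero =>
      intro γ _
      obtain ⟨F, hF, rfl⟩ := exists_mk γ
      refine ⟨F, hF, rfl, ?_⟩
      simpa using hF.continuousAt.isBigO_one ℂ
    | succ b ih =>
      intro γ hγ
      rw [pow_succ'] at hγ
      refine Submodule.mul_induction_on hγ ?_ ?_
      · intro α hα β hβ
        obtain ⟨B, hB, rfl, hBO⟩ := ih β hβ
        obtain ⟨A, hA, rfl⟩ := exists_mk α
        refine ⟨_, hA.mul hB, mk_mul_mk hA hB, ?_⟩
        have h0 : A 0 = 0 := mem_maxIdeal.mp hα
        have hAO : A =O[𝓝 0] fun z => ‖z‖ := by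
          simpa [h0] using hA.differentiableAt.hasFDerivAt.isBigO_sub.norm_right
        simp only [pow_succ']
        exact hAO.mul hBO
      · rintro _ _ ⟨A, hA, rfl, hAO⟩ ⟨B, hB, rfl, hBO⟩
        exact ⟨_, hA.add hB, mk_add_mk hA hB, hAO.add hBO⟩
  intro F hF h
  obtain ⟨G, hG, hFG, hGO⟩ := main _ h
  rw [mk_eq_mk] at hFG
  exact hFG.trans_isBigO hGO

theorem analyticAt_eval_comp {σ : Type*} {W : σ → (Fin n → ℂ) → ℂ}
    (hW : ∀ i, AnalyticAt ℂ (W i) 0) (h : MvPolynomial σ ℂ) :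
    AnalyticAt ℂ (fun z => eval (fun i => W i z) h) 0 :=
  AnalyticAt.aeval_mvPolynomial hW h

theorem aeval_mk {σ : Type*} (W : σ → (Fin n → ℂ) → ℂ) (hW : ∀ i, AnalyticAt ℂ (W i) 0)
    (h : MvPolynomial σ ℂ) (hh : AnalyticAt ℂ (fun z => eval (fun i => W i z) h) 0) :
    aeval (fun i => mk (W i) (hW i)) h = mk (fun z => eval (fun i => W i z) h) hh := by
  induction h using MvPolynomial.induction_on with
  | C c =>
    rw [algHom_C, algebraMap_eq_const, const_apply, mk_eq_mk]
    exact Filter.Eventually.of_forall fun z => by simp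
  | add p q hp hq =>
    rw [map_add, hp (analyticAt_eval_comp hW p), hq (analyticAt_eval_comp hW q),
      mk_add_mk, mk_eq_mk]
    exact Filter.Eventually.of_forall fun z => by simp
  | mul_X p i hp =>
    rw [map_mul, hp (analyticAt_eval_comp hW p), aeval_X, mk_mul_mk, mk_eq_mk]
    exact Filter.Eventually.of_forall fun z => by simp

/-- Taylor expansion in the parameters w: subtract the value at the origin, write the rest as Σ a_i
w_i and expand each a_i to one order less. -/
theorem exists_aeval_sub_mem_pow {w : Fin n → HolGerm n}
    (hw : maxIdeal n = Ideal.span (Set.range w)) (b : ℕ) :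
    ∀ γ : HolGerm n, ∃ h : MvPolynomial (Fin n) ℂ, γ - aeval w h ∈ maxIdeal n ^ b := by
  induction b with
  | zero => exact fun γ => ⟨0, by simp⟩
  | succ b ih =>
    intro γ
    have h1 : γ - const n (valueHom n γ) ∈ maxIdeal n := by
      rw [mem_maxIdeal, map_sub, valueHom_const, sub_self]
    rw [hw] at h1
    obtain ⟨a, ha⟩ := exists_dotProduct_of_mem_span h1
    choose p hp using fun i => ih (a i)
    refine ⟨C (valueHom n γ) + ∑ i, p i * X i, ?_⟩
    have : γ - aeval w (C (valueHom n γ) + ∑ i, p i * X i) =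
        ∑ i, (a i - aeval w (p i)) * w i := by
      simp only [map_add, map_sum, map_mul, aeval_X, algHom_C, algebraMap_eq_const, sub_mul,
        Finset.sum_sub_distrib]
      rw [← sub_sub, ha, dotProduct]
    rw [this]
    refine Ideal.sum_mem _ fun i _ => ?_
    rw [pow_succ]
    refine Ideal.mul_mem_mul (hp i) ?_
    rw [hw]
    exact Ideal.subset_span ⟨i, rfl⟩

/-- The map w has the identity as its differential at the origin. It is therefore open there with
‖z‖ = O(‖w(z)‖), and an estimate in z becomes one in y = w(z). -/
theorem mem_pow_idealOfVars_of_aeval_mem {w : Fin n → HolGerm n} (hw : ∀ i, w i ∈ maxIdeal n)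
    (hd : ∀ i j, valueHom n (partialDeriv j (w i)) = if i = j then 1 else 0) {b : ℕ}
    {h : MvPolynomial (Fin n) ℂ} (hh : aeval w h ∈ maxIdeal n ^ b) :
    h ∈ idealOfVars (Fin n) ℂ ^ b := by
  choose W hW hwW using fun i => exists_mk (w i)
  obtain rfl : w = fun i => mk (W i) (hW i) := _root_.funext hwW
  rw [aeval_mk W hW h (analyticAt_eval_comp hW h)] at hh
  have hO := isBigO_of_mem_pow hh
  have hWd : HasStrictFDerivAt (fun z i => W i z)
      ((ContinuousLinearEquiv.refl ℂ (Fin n → ℂ) : (Fin n → ℂ) →L[ℂ] (Fin n → ℂ))) 0 := by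
    rw [hasStrictFDerivAt_pi']
    intro i
    convert (hW i).hasStrictFDerivAt using 1
    apply ContinuousLinearMap.coe_injective
    refine (Pi.basisFun ℂ (Fin n)).ext fun j => ?_
    have : fderiv ℂ (W i) 0 (Pi.single j 1) = if i = j then 1 else 0 := hd i j
    simp [this, Pi.single_apply]
  have hW0 : (fun i => W i 0) = (0 : Fin n → ℂ) := _root_.funext fun i => mem_maxIdeal.mp (hw i)
  have hmap := hWd.map_nhds_eq_of_equiv
  rw [hW0] at hmap
  have hrev : (fun z : Fin n → ℂ => ‖z‖) =O[𝓝 0] fun z => ‖(fun i => W i z : Fin n → ℂ)‖ := by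
    have hlo := hWd.hasFDerivAt.isLittleO
    simp only [hW0, sub_zero, ContinuousLinearEquiv.coe_coe, ContinuousLinearEquiv.refl_apply]
      at hlo
    simpa using hlo.right_isBigO_add.norm_norm
  apply mem_pow_idealOfVars_of_isBigO
  rw [← hmap, isBigO_map]
  exact hO.trans (hrev.pow b)

end HolGerm

/-! ### Derivatives of germs and the Tjurina ideal -/

namespace HolGerm

open MvPolynomial

variable {n : ℕ}

theorem analyticAt_partial {F : (Fin n → ℂ) → ℂ} (hF : AnalyticAt ℂ F 0) (i : Fin n) :
    AnalyticAt ℂ (fun z => fderiv ℂ F z (Pi.single i 1)) 0 :=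
  ((ContinuousLinearMap.apply ℂ ℂ (Pi.single i (1 : ℂ) : Fin n → ℂ)).analyticAt _).comp hF.fderiv

theorem partialDeriv_mk {F : (Fin n → ℂ) → ℂ} (hF : AnalyticAt ℂ F 0) (i : Fin n) :
    partialDeriv i (mk F hF) =
      mk (fun z => fderiv ℂ F z (Pi.single i 1)) (analyticAt_partial hF i) := rfl

theorem partialDeriv_const (i : Fin n) (c : ℂ) : partialDeriv i (const n c) = 0 := by
  rw [const_apply, partialDeriv_mk, zero_eq_mk, mk_eq_mk]
  exact Filter.Eventually.of_forall fun z => by simp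

theorem partialDeriv_add (i : Fin n) (α β : HolGerm n) :
    partialDeriv i (α + β) = partialDeriv i α + partialDeriv i β := by
  obtain ⟨A, hA, rfl⟩ := exists_mk α
  obtain ⟨B, hB, rfl⟩ := exists_mk β
  rw [mk_add_mk, partialDeriv_mk, partialDeriv_mk, partialDeriv_mk, mk_add_mk, mk_eq_mk]
  filter_upwards [hA.eventually_analyticAt, hB.eventually_analyticAt] with z h1 h2
  rw [fderiv_fun_add h1.differentiableAt h2.differentiableAt]
  simp

theorem partialDeriv_mul (i : Fin n) (α β : HolGerm n) :
    partialDeriv i (α * β) = α * partialDeriv i β + β * partialDeriv i α := by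
  obtain ⟨A, hA, rfl⟩ := exists_mk α
  obtain ⟨B, hB, rfl⟩ := exists_mk β
  rw [mk_mul_mk, partialDeriv_mk, partialDeriv_mk, partialDeriv_mk, mk_mul_mk, mk_mul_mk,
    mk_add_mk, mk_eq_mk]
  filter_upwards [hA.eventually_analyticAt, hB.eventually_analyticAt] with z h1 h2
  rw [fderiv_fun_mul h1.differentiableAt h2.differentiableAt]
  simp

/-- The chain rule for polynomials in holomorphic germs. -/
theorem partialDeriv_aeval {σ : Type*} [Fintype σ] (i : Fin n) (Φ : σ → HolGerm n)
    (q : MvPolynomial σ ℂ) :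
    partialDeriv i (aeval Φ q) = ∑ j, aeval Φ (pderiv j q) * partialDeriv i (Φ j) := by
  classical
  induction q using MvPolynomial.induction_on with
  | C c => simp [algebraMap_eq_const, partialDeriv_const]
  | add p q hp hq => simp [partialDeriv_add, hp, hq, add_mul, Finset.sum_add_distrib]
  | mul_X p k hp =>
    simp only [map_mul, aeval_X, partialDeriv_mul, hp, Derivation.leibniz, pderiv_X, smul_eq_mul,
      map_add, add_mul, Finset.sum_add_distrib, Finset.mul_sum]
    congr 1
    · rw [Finset.sum_eq_single k]
      · simp
      · intro j _ hj
        simp [hj.symm]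
      · simp
    · exact Finset.sum_congr rfl fun j _ => by ring

/-- Leibniz's rule. Used for a unit and for its inverse, it shows that the Tjurina ideal, and with
it a(g), depends on g only up to units. -/
theorem tjurinaIdeal_mul_le (g u : HolGerm n) :
    jacobianIdeal (g * u) ⊔ Ideal.span {g * u} ≤ jacobianIdeal g ⊔ Ideal.span {g} := by
  have hg : g ∈ jacobianIdeal g ⊔ Ideal.span {g} :=
    le_sup_right (a := jacobianIdeal g) (Ideal.mem_span_singleton_self g)
  refine sup_le ?_ ?_
  · rw [jacobianIdeal, Ideal.span_le]
    rintro _ ⟨i, rfl⟩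
    simp only [partialDeriv_mul]
    refine Ideal.add_mem _ (Ideal.mul_mem_right _ _ hg) (Ideal.mul_mem_left _ _ ?_)
    exact le_sup_left (b := Ideal.span {g}) (Ideal.subset_span ⟨i, rfl⟩)
  · rw [Ideal.span_singleton_le_iff_mem]
    exact Ideal.mul_mem_right _ _ hg

theorem tjurinaIdeal_eq_of_associated {g g' : HolGerm n} (h : Associated g g') :
    jacobianIdeal g ⊔ Ideal.span {g} = jacobianIdeal g' ⊔ Ideal.span {g'} := by
  apply le_antisymm
  · obtain ⟨u, hu⟩ := h.symm
    rw [← hu]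
    exact tjurinaIdeal_mul_le _ _
  · obtain ⟨u, hu⟩ := h
    rw [← hu]
    exact tjurinaIdeal_mul_le _ _

theorem mem_of_mulVec_mem {R ι : Type*} [CommRing R] [Fintype ι] [DecidableEq ι] {I : Ideal R}
    {M : Matrix ι ι R} (hM : IsUnit M.det) {x : ι → R} (h : ∀ i, M.mulVec x i ∈ I) (i : ι) :
    x i ∈ I := by
  have : x = M⁻¹.mulVec (M.mulVec x) := by
    rw [Matrix.mulVec_mulVec, Matrix.nonsing_inv_mul _ hM, Matrix.one_mulVec]
  rw [this]
  exact Ideal.sum_mem _ fun j _ => Ideal.mul_mem_left _ _ (h j)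

/-- The matrix whose rows are the values at the origin of `Φ` and of its partial derivatives. -/
noncomputable def frame (Φ : Fin (n + 1) → HolGerm n) : Matrix (Fin (n + 1)) (Fin (n + 1)) ℂ :=
  Matrix.of (Fin.cons (fun j => valueHom n (Φ j))
    fun i j => valueHom n (partialDeriv i (Φ j)))

/-- For a homogeneous polynomial and a transversal slice to the lines through the origin, the
Tjurina ideal is generated by the pullbacks of the partial derivatives. -/
theorem tjurinaIdeal_aeval {Φ : Fin (n + 1) → HolGerm n} (hΦ : IsUnit (frame Φ))
    {f : MvPolynomial (Fin (n + 1)) ℂ} {N : ℕ} (hf : f.IsHomogeneous N) (hN : N ≠ 0) :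
    jacobianIdeal (aeval Φ f) ⊔ Ideal.span {aeval Φ f} =
      Ideal.span (Set.range fun j => aeval Φ (pderiv j f)) := by
  have heuler : ∑ j, Φ j * aeval Φ (pderiv j f) = const n N * aeval Φ f := by
    have := congrArg (aeval Φ) hf.sum_X_mul_pderiv
    simpa [map_sum] using this
  have hNunit : IsUnit (const n N) := (IsUnit.mk0 (N : ℂ) (by exact_mod_cast hN)).map (const n)
  apply le_antisymm
  · refine sup_le ?_ ?_
    · rw [jacobianIdeal, Ideal.span_le]
      rintro _ ⟨i, rfl⟩
      simp only [partialDeriv_aeval]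
      exact Ideal.sum_mem _ fun j _ => Ideal.mul_mem_right _ _ (Ideal.subset_span ⟨j, rfl⟩)
    · rw [Ideal.span_singleton_le_iff_mem, ← Ideal.unit_mul_mem_iff_mem _ hNunit, ← heuler]
      exact Ideal.sum_mem _ fun j _ => Ideal.mul_mem_left _ _ (Ideal.subset_span ⟨j, rfl⟩)
  · rw [Ideal.span_le]
    rintro _ ⟨j, rfl⟩
    -- Applied to the pulled-back partial derivatives, the first row gives a multiple of the
    -- pullback of f by Euler's relation, and the others give its derivatives by the chain rule. The
    -- matrix is invertible because its value at the origin is `frame Φ`.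
    let M : Matrix (Fin (n + 1)) (Fin (n + 1)) (HolGerm n) :=
      Matrix.of (Fin.cons Φ fun i j => partialDeriv i (Φ j))
    have hM : IsUnit M.det := by
      apply isUnit_of_valueHom_ne_zero
      have : (valueHom n).mapMatrix M = frame Φ := by
        ext i j
        refine Fin.cases ?_ (fun i => ?_) i <;> simp [M, frame]
      rw [RingHom.map_det, this]
      exact ((Matrix.isUnit_iff_isUnit_det _).mp hΦ).ne_zero
    refine mem_of_mulVec_mem hM (x := fun j => aeval Φ (pderiv j f)) (fun i => ?_) j
    refine Fin.cases ?_ (fun i => ?_) i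
    · simp only [Matrix.mulVec, dotProduct, M, Matrix.of_apply, Fin.cons_zero, heuler]
      exact Ideal.mul_mem_left _ _ (le_sup_right (a := jacobianIdeal (aeval Φ f))
        (Ideal.mem_span_singleton_self _))
    · have : M.mulVec (fun j => aeval Φ (pderiv j f)) i.succ = partialDeriv i (aeval Φ f) := by
        simp only [Matrix.mulVec, dotProduct, M, Matrix.of_apply, Fin.cons_succ,
          partialDeriv_aeval]
        exact Finset.sum_congr rfl fun j _ => mul_comm _ _
      rw [this]
      exact le_sup_left (b := Ideal.span {aeval Φ f}) (Ideal.subset_span ⟨i, rfl⟩)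

end HolGerm

/-! ### Affine charts of projective space -/

namespace MvPolynomial

variable {K : Type*} [Field K] {n : ℕ}

/-- Restriction of polynomials to the affine chart `B 0 + ∑ yᵢ • B (i + 1)`. -/
noncomputable def dehomogenize (B : Matrix (Fin (n + 1)) (Fin (n + 1)) K) :
    MvPolynomial (Fin (n + 1)) K →ₐ[K] MvPolynomial (Fin n) K :=
  aeval fun j => C (B 0 j) + ∑ i : Fin n, C (B i.succ j) * X i

/-- The linear forms dual to the rows of `B`. -/
noncomputable def dualForm (B : Matrix (Fin (n + 1)) (Fin (n + 1)) K) (k : Fin (n + 1)) :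
    MvPolynomial (Fin (n + 1)) K := linearForm fun j => B⁻¹ j k

variable {B : Matrix (Fin (n + 1)) (Fin (n + 1)) K}

theorem dehomogenize_X (j : Fin (n + 1)) :
    dehomogenize B (X j) = C (B 0 j) + ∑ i : Fin n, C (B i.succ j) * X i := by
  simp [dehomogenize]

theorem dehomogenize_linearForm (c : Fin (n + 1) → K) :
    dehomogenize B (linearForm c) = C (c ⬝ᵥ B 0) + ∑ i : Fin n, C (c ⬝ᵥ B i.succ) * X i := by
  simp only [linearForm, map_sum, map_mul, dehomogenize_X, algHom_C, algebraMap_eq, dotProduct,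
    mul_add, Finset.sum_add_distrib, Finset.sum_mul, Finset.mul_sum]
  rw [Finset.sum_comm]
  simp only [mul_assoc]

theorem dual_dotProduct (hB : IsUnit B) (k l : Fin (n + 1)) :
    (fun j => B⁻¹ j k) ⬝ᵥ B l = if l = k then 1 else 0 := by
  have := congrFun (congrFun (Matrix.mul_nonsing_inv B ((Matrix.isUnit_iff_isUnit_det _).mp hB)) l) k
  rw [Matrix.mul_apply, Matrix.one_apply] at this
  rw [← this, dotProduct]
  exact Finset.sum_congr rfl fun j _ => mul_comm _ _

theorem dehomogenize_dualForm_zero (hB : IsUnit B) : dehomogenize B (dualForm B 0) = 1 := by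
  simp [dualForm, dehomogenize_linearForm, dual_dotProduct hB]

theorem dehomogenize_dualForm_succ (hB : IsUnit B) (i : Fin n) :
    dehomogenize B (dualForm B i.succ) = X i := by
  rw [dualForm, dehomogenize_linearForm, dual_dotProduct hB, if_neg (Fin.succ_ne_zero i).symm,
    C_0, zero_add, Finset.sum_eq_single i]
  · simp [dual_dotProduct hB]
  · intro j _ hj
    simp [dual_dotProduct hB, hj]
  · simp

theorem sum_dualForm (hB : IsUnit B) (j : Fin (n + 1)) :
    (X j : MvPolynomial (Fin (n + 1)) K) = C (B 0 j) * dualForm B 0 +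
      ∑ i : Fin n, C (B i.succ j) * dualForm B i.succ := by
  rw [← Fin.sum_univ_succ fun k => C (B k j) * dualForm B k]
  simp only [dualForm, ← linearCombination_X, ← smul_eq_C_mul, ← map_smul, ← map_sum]
  have h : ∑ k, B k j • (fun l => B⁻¹ l k) = (Pi.single j 1 : Fin (n + 1) → K) := by
    ext l
    have := congrFun (congrFun (Matrix.nonsing_inv_mul B
      ((Matrix.isUnit_iff_isUnit_det _).mp hB)) l) j
    rw [Matrix.mul_apply, Matrix.one_apply] at this
    simp only [Finset.sum_apply, Pi.smul_apply, smul_eq_mul, Pi.single_apply, ← this]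
    exact Finset.sum_congr rfl fun k _ => mul_comm _ _
  rw [h]
  simp

theorem eval_dehomogenize (z : Fin n → K) (q : MvPolynomial (Fin (n + 1)) K) :
    eval z (dehomogenize B q) = eval (fun j => B 0 j + ∑ i : Fin n, B i.succ j * z i) q := by
  have : (aeval z).comp (dehomogenize B) =
      aeval (R := K) fun j => B 0 j + ∑ i : Fin n, B i.succ j * z i := by
    ext j
    simp [dehomogenize_X]
  simpa [aeval_eq_eval] using DFunLike.congr_fun this q

theorem constantCoeff_dehomogenize (q : MvPolynomial (Fin (n + 1)) K) :
    constantCoeff (dehomogenize B q) = eval (B 0) q := by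
  rw [← eval_zero, eval_dehomogenize]
  simp

theorem dehomogenize_mem_idealOfVars {q : MvPolynomial (Fin (n + 1)) K}
    (hq : q ∈ lineIdeal (B 0)) : dehomogenize B q ∈ idealOfVars (Fin n) K := by
  rw [idealOfVars_eq_ker, RingHom.mem_ker, constantCoeff_dehomogenize]
  exact eval_eq_zero_of_mem_lineIdeal hq

theorem dehomogenize_mem_idealOfVars_pow {q : MvPolynomial (Fin (n + 1)) K} {a : ℕ}
    (hq : q ∈ lineIdeal (B 0) ^ a) : dehomogenize B q ∈ idealOfVars (Fin n) K ^ a := by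
  have h1 : (lineIdeal (B 0)).map (dehomogenize B) ≤ idealOfVars (Fin n) K :=
    Ideal.map_le_iff_le_comap.mpr fun q hq => dehomogenize_mem_idealOfVars hq
  have h2 := Ideal.mem_map_of_mem (dehomogenize B) hq
  rw [Ideal.map_pow] at h2
  exact Ideal.pow_right_mono h1 a h2

/-- Polynomials in the dual forms. -/
theorem exists_dehomogenize_eq_of_mem_pow (hB : IsUnit B) {h : MvPolynomial (Fin n) K} {b : ℕ}
    (hh : h ∈ idealOfVars (Fin n) K ^ b) :
    ∃ q ∈ lineIdeal (B 0) ^ b, dehomogenize B q = h := by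
  let ε : MvPolynomial (Fin n) K →ₐ[K] MvPolynomial (Fin (n + 1)) K :=
    aeval fun i => dualForm B i.succ
  have hε : (dehomogenize B).comp ε = AlgHom.id K _ := by
    ext1 i
    simp [ε, dehomogenize_dualForm_succ hB]
  refine ⟨ε h, ?_, DFunLike.congr_fun hε h⟩
  have h1 : (idealOfVars (Fin n) K).map ε ≤ lineIdeal (B 0) := by
    rw [Ideal.map_le_iff_le_comap, idealOfVars_le_iff]
    intro i
    rw [Ideal.mem_comap]
    simp only [ε, aeval_X]
    exact linearForm_mem_lineIdeal (by
      rw [dual_dotProduct hB, if_neg (Fin.succ_ne_zero i).symm])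
  have h2 := Ideal.mem_map_of_mem ε hh
  rw [Ideal.map_pow] at h2
  exact Ideal.pow_right_mono h1 b h2

/-- Homogenization. -/
theorem exists_isHomogeneous_dehomogenize_eq (hB : IsUnit B) (p : MvPolynomial (Fin n) K) {E : ℕ}
    (hE : p.totalDegree ≤ E) :
    ∃ P : MvPolynomial (Fin (n + 1)) K, P.IsHomogeneous E ∧ dehomogenize B P = p := by
  let ε : MvPolynomial (Fin n) K →ₐ[K] MvPolynomial (Fin (n + 1)) K :=
    aeval fun i => dualForm B i.succ
  have hε : (dehomogenize B).comp ε = AlgHom.id K _ := by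
    ext1 i
    simp [ε, dehomogenize_dualForm_succ hB]
  refine ⟨∑ k ∈ Finset.range (p.totalDegree + 1),
    ε (homogeneousComponent k p) * dualForm B 0 ^ (E - k), ?_, ?_⟩
  · refine IsHomogeneous.sum _ _ _ fun k hk => ?_
    have h1 : (ε (homogeneousComponent k p)).IsHomogeneous (1 * k) :=
      (homogeneousComponent_isHomogeneous k p).aeval _ fun i => isHomogeneous_linearForm _
    have h2 : (dualForm B 0 ^ (E - k)).IsHomogeneous (1 * (E - k)) :=
      (isHomogeneous_linearForm _).pow _
    convert h1.mul h2 using 1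
    have := Finset.mem_range.mp hk
    omega
  · rw [map_sum]
    conv_rhs => rw [← sum_homogeneousComponent p]
    refine Finset.sum_congr rfl fun k _ => ?_
    rw [map_mul, map_pow, dehomogenize_dualForm_zero hB, one_pow, mul_one]
    exact DFunLike.congr_fun hε _

/-- Points where the form `dualForm B 0` is nonzero are multiples of points of the chart, so q
vanishes there and the product of q with this form vanishes everywhere. -/
theorem IsHomogeneous.eq_zero_of_dehomogenize [Infinite K] (hB : IsUnit B)
    {q : MvPolynomial (Fin (n + 1)) K} {m : ℕ} (hq : q.IsHomogeneous m)
    (h : dehomogenize B q = 0) : q = 0 := by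
  have hne : dualForm B 0 ≠ 0 := by
    intro h0
    have := dehomogenize_dualForm_zero hB
    rw [h0, map_zero] at this
    exact zero_ne_one this
  refine (mul_eq_zero.mp ?_).resolve_left hne
  refine MvPolynomial.funext fun x => ?_
  rw [map_mul, map_zero]
  by_cases ht : eval x (dualForm B 0) = 0
  · rw [ht, zero_mul]
  · have hx : x = eval x (dualForm B 0) •
        fun j => B 0 j + ∑ i : Fin n, B i.succ j * (eval x (dualForm B i.succ) /
          eval x (dualForm B 0)) := by
      ext j
      have := congrArg (eval x) (sum_dualForm hB j)
      simp only [eval_X, map_add, map_mul, eval_C, map_sum] at this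
      rw [this]
      simp only [Pi.smul_apply, smul_eq_mul, mul_add, Finset.mul_sum]
      congr 1
      · ring
      · exact Finset.sum_congr rfl fun i _ => by field_simp
    have h2 : eval x q = 0 := by
      rw [hx, hq.eval_smul, ← eval_dehomogenize, h, map_zero, mul_zero]
    rw [h2, mul_zero]

/-- Local membership in a homogeneous ideal can be checked in an affine chart. -/
theorem exists_mul_mem_of_dehomogenize [Infinite K] (hB : IsUnit B) {ι : Type*} [Fintype ι] {d D : ℕ}
    {F : ι → MvPolynomial (Fin (n + 1)) K} (hF : ∀ j, (F j).IsHomogeneous d)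
    {H : MvPolynomial (Fin (n + 1)) K} (hH : H.IsHomogeneous D) {s : MvPolynomial (Fin n) K}
    (hs : constantCoeff s ≠ 0)
    (h : s * dehomogenize B H ∈ Ideal.span (Set.range fun j => dehomogenize B (F j))) :
    ∃ (S : MvPolynomial (Fin (n + 1)) K) (e : ℕ), S.IsHomogeneous e ∧ eval (B 0) S ≠ 0 ∧
      S * H ∈ Ideal.span (Set.range F) := by
  obtain ⟨c, hc⟩ := exists_dotProduct_of_mem_span h
  set E := max s.totalDegree (Finset.univ.sup fun j => (c j).totalDegree) with hE
  -- The padding to degrees E + d and E + D gives S * H and all G j * F j the common degree E + d +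
  -- D, so their relation may be checked in the chart.
  obtain ⟨S, hS, hSs⟩ := exists_isHomogeneous_dehomogenize_eq hB s (E := E + d)
    ((le_max_left _ _).trans (Nat.le_add_right _ _))
  choose G hG hGc using fun j => exists_isHomogeneous_dehomogenize_eq hB (c j) (E := E + D)
    (((Finset.le_sup (f := fun j => (c j).totalDegree) (Finset.mem_univ j)).trans
      (le_max_right _ _)).trans (Nat.le_add_right _ _))
  refine ⟨S, E + d, hS, ?_, ?_⟩
  · rwa [← constantCoeff_dehomogenize, hSs]
  · have h1 : (S * H - ∑ j, G j * F j).IsHomogeneous (E + d + D) := by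
      refine (hS.mul hH).sub (IsHomogeneous.sum _ _ _ fun j _ => ?_)
      have := (hG j).mul (hF j)
      rwa [show E + D + d = E + d + D by ring] at this
    have h2 := h1.eq_zero_of_dehomogenize hB (by
      simp [hSs, hGc, hc, dotProduct])
    rw [sub_eq_zero.mp h2]
    exact dotProduct_mem_span G F

end MvPolynomial

/-! ### From holomorphic to algebraic local membership -/

namespace HolGerm

open MvPolynomial

variable {n : ℕ} {Φ : Fin (n + 1) → HolGerm n}

theorem valueHom_aeval (q : MvPolynomial (Fin (n + 1)) ℂ) :
    valueHom n (aeval Φ q) = eval (frame Φ 0) q := by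
  induction q using MvPolynomial.induction_on with
  | C c => simp [algebraMap_eq_const]
  | add p q hp hq => simp [hp, hq]
  | mul_X p i hp => simp [hp, frame]

theorem valueHom_partialDeriv_linearForm (c : Fin (n + 1) → ℂ) (i : Fin n) :
    valueHom n (partialDeriv i (aeval Φ (linearForm c))) = c ⬝ᵥ frame Φ i.succ := by
  classical
  have : ∀ k, pderiv k (linearForm c) = C (c k) := by
    intro k
    simp only [linearForm, map_sum, Derivation.leibniz, pderiv_C, pderiv_X, smul_eq_mul]
    rw [Finset.sum_eq_single k]
    · simp
    · intro j _ hj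
      simp [hj]
    · simp
  simp [partialDeriv_aeval, this, algebraMap_eq_const, frame, dotProduct]

/-- Affine coordinates along a slice `Φ` transversal to the lines through the origin. -/
theorem exists_affine_coordinates (hΦ : IsUnit (frame Φ)) :
    ∃ (τ : HolGerm n) (w : Fin n → HolGerm n), IsUnit τ ∧ (∀ i, w i ∈ maxIdeal n) ∧
      (∀ i j, valueHom n (partialDeriv j (w i)) = if i = j then 1 else 0) ∧
      ∀ (q : MvPolynomial (Fin (n + 1)) ℂ) (k : ℕ), q.IsHomogeneous k →
        aeval Φ q = τ ^ k * aeval w (dehomogenize (frame Φ) q) := by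
  set B := frame Φ with hB
  set τ := aeval Φ (dualForm B 0) with hτ
  have hτv : valueHom n τ = 1 := by
    rw [hτ, valueHom_aeval, dualForm, eval_linearForm, dual_dotProduct hΦ, if_pos rfl]
  have hτu : IsUnit τ := isUnit_of_valueHom_ne_zero (by rw [hτv]; exact one_ne_zero)
  obtain ⟨ρ, hρ⟩ := hτu.exists_right_inv
  have hρv : valueHom n ρ = 1 := by
    have := congrArg (valueHom n) hρ
    rwa [map_mul, hτv, one_mul, map_one] at this
  have hav : ∀ i : Fin n, valueHom n (aeval Φ (dualForm B i.succ)) = 0 := by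
    intro i
    rw [valueHom_aeval, dualForm, eval_linearForm, dual_dotProduct hΦ,
      if_neg (Fin.succ_ne_zero i).symm]
  -- Affine coordinates are quotients of dual forms by the zeroth one. As τ has value 1 and the
  -- numerators vanish at the origin, Leibniz's rule leaves only the derivatives of the numerators.
  refine ⟨τ, fun i => aeval Φ (dualForm B i.succ) * ρ, hτu, ?_, ?_, ?_⟩
  · intro i
    rw [mem_maxIdeal, map_mul, hav, zero_mul]
  · intro i j
    rw [partialDeriv_mul, map_add, map_mul, map_mul, hav, zero_mul, zero_add, hρv, one_mul,
      dualForm, valueHom_partialDeriv_linearForm, dual_dotProduct hΦ]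
    simp [eq_comm]
  · intro q k hq
    set w : Fin n → HolGerm n := fun i => aeval Φ (dualForm B i.succ) * ρ with hw
    have hcomp : (aeval w).comp (dehomogenize B) =
        aeval (R := ℂ) fun j => aeval w (dehomogenize B (X j)) := by
      ext1 j
      simp
    have hq' := DFunLike.congr_fun hcomp q
    rw [AlgHom.comp_apply] at hq'
    rw [hq', ← hq.aeval_mul]
    congr 2
    ext1 j
    have h1 := congrArg (aeval Φ) (sum_dualForm hΦ j)
    simp only [aeval_X, map_add, map_mul, map_sum, algHom_C] at h1
    rw [h1, dehomogenize_X]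
    simp only [map_add, map_mul, map_sum, algHom_C, aeval_X, mul_add, Finset.mul_sum, hw]
    congr 1
    · rw [mul_comm]
    · refine Finset.sum_congr rfl fun i _ => ?_
      linear_combination (-(algebraMap ℂ (HolGerm n) (B i.succ j)) *
        aeval Φ (dualForm B i.succ)) * hρ

theorem span_range_unit_mul {R ι : Type*} [CommRing R] {u : R} (hu : IsUnit u) (x : ι → R) :
    Ideal.span (Set.range fun i => u * x i) = Ideal.span (Set.range x) := by
  apply le_antisymm
  · rw [Ideal.span_le]
    rintro _ ⟨i, rfl⟩
    exact Ideal.mul_mem_left _ _ (Ideal.subset_span ⟨i, rfl⟩)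
  · rw [Ideal.span_le]
    rintro _ ⟨i, rfl⟩
    refine (Ideal.unit_mul_mem_iff_mem _ hu).mp (Ideal.subset_span ⟨i, rfl⟩)

theorem span_range_map {R A ι : Type*} [CommRing R] [CommRing A] (π : R →+* A) (x : ι → R) :
    Ideal.span (Set.range fun i => π (x i)) = (Ideal.span (Set.range x)).map π := by
  rw [Ideal.map_span, ← Set.range_comp]
  rfl

section

variable {d : ℕ} {ι : Type*} {F : ι → MvPolynomial (Fin (n + 1)) ℂ}
  {s : MvPolynomial (Fin (n + 1)) ℂ} {b : ℕ}

theorem dehomogenize_mul_mem (hΦ : IsUnit (frame Φ))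
    (hsF : ∀ H ∈ lineIdeal (frame Φ 0) ^ b, s * H ∈ Ideal.span (Set.range F))
    {h : MvPolynomial (Fin n) ℂ} (hh : h ∈ idealOfVars (Fin n) ℂ ^ b) :
    dehomogenize (frame Φ) s * h ∈
      Ideal.span (Set.range fun j => dehomogenize (frame Φ) (F j)) := by
  obtain ⟨q, hq, rfl⟩ := exists_dehomogenize_eq_of_mem_pow hΦ hh
  have := Ideal.mem_map_of_mem (dehomogenize (frame Φ)).toRingHom (hsF q hq)
  rw [← span_range_map] at this
  simpa using this

/-- If `F` generates a power of the ideal of a point locally in the Zariski topology, then its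
pullback to a slice contains a power of the maximal ideal. -/
theorem maxIdeal_pow_le (hΦ : IsUnit (frame Φ)) (hF : ∀ j, (F j).IsHomogeneous d)
    (hs : eval (frame Φ 0) s ≠ 0)
    (hsF : ∀ H ∈ lineIdeal (frame Φ 0) ^ b, s * H ∈ Ideal.span (Set.range F)) :
    maxIdeal n ^ b ≤ Ideal.span (Set.range fun j => aeval Φ (F j)) := by
  obtain ⟨τ, w, hτ, hw, hd, hq⟩ := exists_affine_coordinates hΦ
  simp only [fun j => hq (F j) d (hF j)]
  rw [span_range_unit_mul (hτ.pow d)]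
  have hmap : maxIdeal n = (idealOfVars (Fin n) ℂ).map (aeval (R := ℂ) w).toRingHom := by
    rw [maxIdeal_eq_span_of_partialDeriv hw hd, idealOfVars, ← span_range_map]
    simp
  rw [hmap, ← Ideal.map_pow, Ideal.map_le_iff_le_comap]
  intro h hh
  rw [Ideal.mem_comap]
  have h1 := Ideal.mem_map_of_mem (aeval (R := ℂ) w).toRingHom (dehomogenize_mul_mem hΦ hsF hh)
  rw [← span_range_map, map_mul] at h1
  refine (Ideal.unit_mul_mem_iff_mem _ (isUnit_of_valueHom_ne_zero ?_)).mp h1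
  have h2 : (valueHom n).comp (aeval (R := ℂ) w).toRingHom = constantCoeff := by
    ext i
    · simp [algebraMap_eq_const]
    · simpa using mem_maxIdeal.mp (hw i)
  have h3 := DFunLike.congr_fun h2 (dehomogenize (frame Φ) s)
  rw [RingHom.comp_apply, constantCoeff_dehomogenize] at h3
  rwa [h3]

/-- Passage from holomorphic to algebraic local membership: if the pullback of `F` to a slice
contains `𝔪 ^ a`, then locally in the Zariski topology `F` generates the `a`-th power of the
ideal of the point. -/
theorem exists_mul_mem_of_maxIdeal_pow_le [Fintype ι] (hΦ : IsUnit (frame Φ))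
    (hF : ∀ j, (F j).IsHomogeneous d) (hs : eval (frame Φ 0) s ≠ 0)
    (hsF : ∀ H ∈ lineIdeal (frame Φ 0) ^ b, s * H ∈ Ideal.span (Set.range F)) {a : ℕ}
    (ha : maxIdeal n ^ a ≤ Ideal.span (Set.range fun j => aeval Φ (F j)))
    {H : MvPolynomial (Fin (n + 1)) ℂ} {D : ℕ} (hH : H.IsHomogeneous D)
    (hHa : H ∈ lineIdeal (frame Φ 0) ^ a) :
    ∃ (S : MvPolynomial (Fin (n + 1)) ℂ) (e : ℕ), S.IsHomogeneous e ∧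
      eval (frame Φ 0) S ≠ 0 ∧ S * H ∈ Ideal.span (Set.range F) := by
  obtain ⟨τ, w, hτ, hw, hd, hq⟩ := exists_affine_coordinates hΦ
  simp only [fun j => hq (F j) d (hF j)] at ha
  rw [span_range_unit_mul (hτ.pow d)] at ha
  have hspan := maxIdeal_eq_span_of_partialDeriv hw hd
  have hmap : maxIdeal n = (idealOfVars (Fin n) ℂ).map (aeval (R := ℂ) w).toRingHom := by
    rw [hspan, idealOfVars, ← span_range_map]
    simp
  set h := dehomogenize (frame Φ) H with hh
  have hha : h ∈ idealOfVars (Fin n) ℂ ^ a := dehomogenize_mem_idealOfVars_pow hHa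
  have h1 : aeval w h ∈ maxIdeal n ^ a := by
    rw [hmap, ← Ideal.map_pow]
    exact Ideal.mem_map_of_mem (aeval (R := ℂ) w).toRingHom hha
  obtain ⟨c, hc⟩ := exists_dotProduct_of_mem_span (ha h1)
  -- Truncating the holomorphic coefficients at order b makes them polynomials. The error r has
  -- order at least b at the origin, and s multiplies every such polynomial into the ideal.
  choose C hC using fun j => exists_aeval_sub_mem_pow hspan b (c j)
  set r := h - ∑ j, C j * dehomogenize (frame Φ) (F j) with hr
  have h2 : r ∈ idealOfVars (Fin n) ℂ ^ b := by
    apply mem_pow_idealOfVars_of_aeval_mem hw hd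
    have : aeval w r = ∑ j, (c j - aeval w (C j)) * aeval w (dehomogenize (frame Φ) (F j)) := by
      simp only [hr, map_sub, map_sum, map_mul, sub_mul, Finset.sum_sub_distrib, hc, dotProduct]
    rw [this]
    exact Ideal.sum_mem _ fun j _ => Ideal.mul_mem_right _ _ (hC j)
  have h3 := dehomogenize_mul_mem hΦ hsF h2
  refine exists_mul_mem_of_dehomogenize hΦ hF hH (s := dehomogenize (frame Φ) s)
    (by rwa [constantCoeff_dehomogenize]) ?_
  have h4 : dehomogenize (frame Φ) s * h = dehomogenize (frame Φ) s * r +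
      ∑ j, dehomogenize (frame Φ) s * C j * dehomogenize (frame Φ) (F j) := by
    rw [hr, mul_sub, Finset.mul_sum]
    simp only [mul_assoc, sub_add_cancel]
  rw [← hh, h4]
  exact Ideal.add_mem _ h3 (Ideal.sum_mem _ fun j _ =>
    Ideal.mul_mem_left _ _ (Ideal.subset_span ⟨j, rfl⟩))

end

end HolGerm

/-! ### The Jacobian ideal near a singular point -/

namespace MvPolynomial

variable {K : Type*} [Field K] {n : ℕ}

open scoped Pointwise in
/-- A local membership property of products of linear forms extends to the power of the ideal of
a point. -/
theorem exists_mul_mem_of_mem_lineIdeal_pow {J : Ideal (MvPolynomial (Fin n) K)} {v x : Fin n → K}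
    {a : ℕ}
    (h : ∀ H : MvPolynomial (Fin n) K, H.IsHomogeneous a → H ∈ lineIdeal v ^ a →
      ∃ S, eval x S ≠ 0 ∧ S * H ∈ J) {H : MvPolynomial (Fin n) K} (hH : H ∈ lineIdeal v ^ a) :
    ∃ S, eval x S ≠ 0 ∧ S * H ∈ J := by
  have hpow : ∀ k, ∀ H ∈ {p : MvPolynomial (Fin n) K | ∃ c, c ⬝ᵥ v = 0 ∧ p = linearForm c} ^ k,
      H.IsHomogeneous k := by
    intro k
    induction k with
    | zero =>
      intro H hH
      rw [pow_zero, Set.mem_one] at hH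
      rw [hH]
      exact isHomogeneous_one _ _
    | succ k ih =>
      intro H hH
      rw [pow_succ] at hH
      obtain ⟨p, hp, _, ⟨c, -, rfl⟩, rfl⟩ := Set.mem_mul.mp hH
      exact (ih p hp).mul (isHomogeneous_linearForm c)
  have hH' := hH
  rw [lineIdeal, Ideal.span, Submodule.span_pow] at hH'
  refine Submodule.span_induction (p := fun H _ => ∃ S, eval x S ≠ 0 ∧ S * H ∈ J)
    ?_ ?_ ?_ ?_ hH'
  · intro p hp
    refine h p (hpow a p hp) ?_
    rw [lineIdeal, Ideal.span, Submodule.span_pow]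
    exact Submodule.subset_span hp
  · exact ⟨1, by simp, by simp⟩
  · rintro p q - - ⟨S, hS, hSp⟩ ⟨T, hT, hTq⟩
    refine ⟨S * T, by rw [map_mul]; exact mul_ne_zero hS hT, ?_⟩
    have : S * T * (p + q) = T * (S * p) + S * (T * q) := by ring
    rw [this]
    exact J.add_mem (J.mul_mem_left _ hSp) (J.mul_mem_left _ hTq)
  · rintro r p - ⟨S, hS, hSp⟩
    refine ⟨S, hS, ?_⟩
    rw [smul_eq_mul, mul_left_comm]
    exact J.mul_mem_left _ hSp

end MvPolynomial

namespace Hypersurface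

open MvPolynomial HolGerm

variable {n : ℕ}

/-- The rows of the frame are φ(0) and the partial derivatives of φ at 0; a linear relation between
them would contradict injectivity. -/
theorem isUnit_frame {φ : (Fin n → ℂ) → (Fin (n + 1) → ℂ)} (hφ : AnalyticAt ℂ φ 0)
    (hbij : Function.Bijective (fun x : ℂ × (Fin n → ℂ) => x.1 • φ 0 + fderiv ℂ φ 0 x.2)) :
    IsUnit (frame fun j => HolGerm.mk (fun z => φ z j) (analyticAt_pi_iff.mp hφ j)) := by
  have hder : ∀ j, fderiv ℂ (fun z => φ z j) 0 =
      (ContinuousLinearMap.proj j).comp (fderiv ℂ φ 0) := fun j =>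
    (hasFDerivAt_pi'.mp hφ.differentiableAt.hasFDerivAt j).fderiv
  have hrow : ∀ k, frame (fun j => HolGerm.mk (fun z => φ z j) (analyticAt_pi_iff.mp hφ j)) k =
      (Fin.cons (φ 0) fun i => fderiv ℂ φ 0 (Pi.single i 1) : Fin (n + 1) → Fin (n + 1) → ℂ) k := by
    intro k
    refine Fin.cases ?_ (fun i => ?_) k
    · rfl
    · ext j
      simp only [frame, partialDeriv_mk, valueHom_mk, hder, Matrix.of_apply, Fin.cons_succ]
      rfl
  rw [← Matrix.linearIndependent_rows_iff_isUnit, Fintype.linearIndependent_iff]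
  intro c hc
  have h1 : (fun x : ℂ × (Fin n → ℂ) => x.1 • φ 0 + fderiv ℂ φ 0 x.2) (c 0, Fin.tail c) =
      (fun x : ℂ × (Fin n → ℂ) => x.1 • φ 0 + fderiv ℂ φ 0 x.2) (0, 0) := by
    have h2 : fderiv ℂ φ 0 (Fin.tail c) = ∑ i, c i.succ • fderiv ℂ φ 0 (Pi.single i 1) := by
      conv_lhs => rw [pi_eq_sum_univ' (Fin.tail c)]
      simp [Fin.tail]
    simp only [Matrix.row, hrow, Fin.sum_univ_succ, Fin.cons_zero, Fin.cons_succ] at hc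
    simp only [h2, hc]
    simp
  have h3 := hbij.1 h1
  rw [Prod.mk.injEq] at h3
  intro i
  refine Fin.cases h3.1 (fun i => ?_) i
  exact congrFun h3.2 i

/-- The invariant `a(g)` of a local equation: near `p`, the Jacobian ideal contains the `a(g)`-th
power of the ideal of `p`. -/
theorem exists_mul_mem_of_isLocalEquation {N : ℕ} (hN : N ≠ 0) {f : MvPolynomial (Fin (n + 1)) ℂ}
    (hf : f.IsHomogeneous N) {Z : Finset (ℙ ℂ (Fin (n + 1) → ℂ))}
    (hZ : ∀ x (hx : x ≠ 0), (∀ p ∈ Ideal.span (Set.range fun j => pderiv j f), eval x p = 0) →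
      Projectivization.mk ℂ x hx ∈ Z)
    {x : Fin (n + 1) → ℂ} (hx : x ≠ 0) {g : HolGerm n}
    (hg : IsLocalEquation f (Projectivization.mk ℂ x hx) g) {H : MvPolynomial (Fin (n + 1)) ℂ}
    (hH : H ∈ lineIdeal x ^ aInv g) :
    ∃ S, eval x S ≠ 0 ∧ S * H ∈ Ideal.span (Set.range fun j => pderiv j f) := by
  obtain ⟨φ, hφ, h0, hp, hbij, hassoc⟩ := hg
  set Φ : Fin (n + 1) → HolGerm n :=
    fun j => HolGerm.mk (fun z => φ z j) (analyticAt_pi_iff.mp hφ j) with hΦdef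
  have hΦ : IsUnit (frame Φ) := isUnit_frame hφ hbij
  have hv : frame Φ 0 = φ 0 := rfl
  have hpull : pullbackGerm f φ hφ = aeval Φ f :=
    (aeval_mk (fun j z => φ z j) (fun j => analyticAt_pi_iff.mp hφ j) f
      (analyticAt_eval_comp (fun j => analyticAt_pi_iff.mp hφ j) f)).symm
  rw [hpull] at hassoc
  have hideal := (tjurinaIdeal_eq_of_associated hassoc).trans (tjurinaIdeal_aeval hΦ hf hN)
  obtain ⟨s, b, hs, hsb⟩ := exists_mul_pow_lineIdeal_le hZ h0
  have hFhom : ∀ j, (pderiv j f).IsHomogeneous (N - 1) := fun j => hf.pderiv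
  -- An infimum over an empty set of naturals would be 0. The exponent b, from the Nullstellensatz,
  -- shows that the set is nonempty and the minimum is attained.
  have hmem : aInv g ∈ {a : ℕ | maxIdeal n ^ a ≤ jacobianIdeal g ⊔ Ideal.span {g}} := by
    refine Nat.sInf_mem ⟨b, ?_⟩
    rw [Set.mem_ofPred_eq, hideal]
    exact maxIdeal_pow_le hΦ hFhom hs hsb
  rw [Set.mem_ofPred_eq, hideal] at hmem
  obtain ⟨t, ht⟩ := (Projectivization.mk_eq_mk_iff' ℂ (φ 0) x h0 hx).mp hp
  have ht0 : t ≠ 0 := by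
    rintro rfl
    exact h0 (by rw [← ht, zero_smul])
  refine exists_mul_mem_of_mem_lineIdeal_pow (v := x) (fun H hHh hHa => ?_) hH
  obtain ⟨S, e, hSe, hS, hSH⟩ := exists_mul_mem_of_maxIdeal_pow_le hΦ hFhom hs hsb hmem hHh (by
    rwa [hv, ← ht, lineIdeal_smul ht0])
  refine ⟨S, fun hSx => hS ?_, hSH⟩
  rw [hv, ← ht, hSe.eval_smul, hSx, mul_zero]

end Hypersurface

/-! ### The colon ideal (I : J) in low degrees and the conclusion -/

namespace MvPolynomial

variable {K : Type*} [Field K] {n : ℕ}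

attribute [local instance] MvPolynomial.gradedAlgebra

/-- Modulo a linear form without zeros at the points of `Z`, a power of the ideal of the origin
is contained in a product of powers of the ideals of these points. -/
theorem idealOfVars_pow_le_prod_sup {κ : Type*} (Z : Finset κ) (v : κ → Fin n → K) (a : κ → ℕ)
    {c : Fin n → K} (hc : ∀ p ∈ Z, c ⬝ᵥ v p ≠ 0) :
    idealOfVars (Fin n) K ^ (∑ p ∈ Z, a p) ≤
      (∏ p ∈ Z, lineIdeal (v p) ^ a p) ⊔ Ideal.span {linearForm c} := by
  classical
  set π := Ideal.Quotient.mk (Ideal.span {linearForm c}) with hπ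
  have hker : ∀ I : Ideal (MvPolynomial (Fin n) K),
      (I.map π).comap π = I ⊔ Ideal.span {linearForm c} := fun I => by
    rw [Ideal.comap_map_of_surjective π Ideal.Quotient.mk_surjective, ← RingHom.ker_eq_comap_bot,
      Ideal.mk_ker]
  rw [← hker, ← Ideal.map_le_iff_le_comap]
  induction Z using Finset.induction_on with
  | empty => simp
  | insert p Z hp ih =>
    rw [Finset.sum_insert hp, Finset.prod_insert hp, pow_add, Ideal.map_mul, Ideal.map_mul]
    refine Ideal.mul_mono ?_ (ih fun q hq => hc q (Finset.mem_insert_of_mem hq))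
    rw [Ideal.map_pow, Ideal.map_pow]
    refine Ideal.pow_right_mono ?_ _
    rw [Ideal.map_le_iff_le_comap, hker]
    exact idealOfVars_le_lineIdeal_sup (hc p (Finset.mem_insert_self p Z))

/-- Iteration of the socle condition. -/
theorem mem_of_forall_pow_idealOfVars_mul_mem {I : Ideal (MvPolynomial (Fin n) K)} {T : ℕ}
    (hsoc : ∀ m (h : MvPolynomial (Fin n) K), h.IsHomogeneous m → m < T →
      (∀ i, X i * h ∈ I) → h ∈ I) (E : ℕ) :
    ∀ (m : ℕ) (h : MvPolynomial (Fin n) K), h.IsHomogeneous m → m + E ≤ T →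
      (∀ u ∈ idealOfVars (Fin n) K ^ E, u * h ∈ I) → h ∈ I := by
  induction E with
  | zero => exact fun m h _ _ hu => by simpa using hu 1 (by simp)
  | succ E ih =>
    intro m h hh hm hu
    refine hsoc m h hh (by omega) fun i => ?_
    refine ih (m + 1) _ (by simpa [mul_comm] using hh.mul (isHomogeneous_X K i)) (by omega) ?_
    intro u hu'
    rw [← mul_assoc]
    refine hu _ ?_
    rw [pow_succ]
    exact Ideal.mul_mem_mul hu' (X_mem_idealOfVars i)

end MvPolynomial

namespace Hypersurface

open MvPolynomial HolGerm

attribute [local instance] MvPolynomial.gradedAlgebra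

variable {n : ℕ}

/-- By skew-symmetry, weighting the Koszul relations with the entries of M counts the product of M
with the gradient twice, and 2 is invertible. -/
theorem mem_KR_of_isKoszul {f : MvPolynomial (Fin (n + 1)) ℂ}
    {a : Fin (n + 1) → MvPolynomial (Fin (n + 1)) ℂ} (h : IsKoszul (fun j => pderiv j f) a) :
    a ∈ KR f := by
  obtain ⟨M, hM, rfl⟩ := h
  have hsum : ∑ i, ∑ j, M i j • (Pi.single i (pderiv j f) - Pi.single j (pderiv i f) :
      Fin (n + 1) → MvPolynomial (Fin (n + 1)) ℂ) = (2 : MvPolynomial (Fin (n + 1)) ℂ) •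
        M.mulVec fun j => pderiv j f := by
    have hMij : ∀ i j, M j i = -M i j := fun i j => congrFun (congrFun hM i) j
    ext1 k
    simp only [Finset.sum_apply, Pi.smul_apply, Pi.sub_apply, smul_eq_mul, mul_sub,
      Finset.sum_sub_distrib, Pi.single_apply, mul_ite, mul_zero, Matrix.mulVec, dotProduct]
    rw [Finset.sum_comm]
    simp only [Finset.sum_ite_eq, Finset.mem_univ, if_true]
    rw [two_mul, sub_eq_add_neg, ← Finset.sum_neg_distrib]
    congr 1
    exact Finset.sum_congr rfl fun j _ => by rw [hMij k j]; ring
  obtain ⟨u, hu⟩ := (isUnit_two (K := ℂ) (σ := Fin (n + 1))).exists_left_inv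
  rw [← one_smul (MvPolynomial (Fin (n + 1)) ℂ) (M.mulVec _), ← hu, mul_smul, ← hsum]
  refine Submodule.smul_mem _ _ (Submodule.sum_mem _ fun i _ => Submodule.sum_mem _ fun j _ =>
    Submodule.smul_mem _ _ (Submodule.subset_span ⟨(i, j), rfl⟩))

/-- The common zeros of the partial derivatives are the singular points. -/
theorem mk_mem_singularSet {N : ℕ} (hN : N ≠ 0) {f : MvPolynomial (Fin (n + 1)) ℂ}
    (hf : f.IsHomogeneous N) {x : Fin (n + 1) → ℂ} (hx : x ≠ 0)
    (h : ∀ j, eval x (pderiv j f) = 0) : Projectivization.mk ℂ x hx ∈ singularSet f := by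
  obtain ⟨a, ha⟩ := Projectivization.exists_smul_eq_mk_rep ℂ x hx
  have h1 : ∀ j, eval (Projectivization.mk ℂ x hx).rep (pderiv j f) = 0 := by
    intro j
    rw [← ha, Units.smul_def, hf.pderiv.eval_smul, h, mul_zero]
  refine ⟨?_, h1⟩
  have h2 := congrArg (eval (Projectivization.mk ℂ x hx).rep) hf.sum_X_mul_pderiv
  simp only [map_sum, map_mul, h1, mul_zero, Finset.sum_const_zero, nsmul_eq_mul, map_natCast]
    at h2
  exact (mul_eq_zero.mp h2.symm).resolve_left (by exact_mod_cast hN)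

section

variable {e : ℕ} {f : MvPolynomial (Fin (n + 1)) ℂ} {g : ℙ ℂ (Fin (n + 1) → ℂ) → HolGerm n}

/-- A polynomial that multiplies the Jacobian ideal into `I` multiplies into `I` every polynomial
vanishing to the order `a(g p)` at all singular points `p`. -/
theorem mul_mem_of_mem_prod_lineIdeal (hf : f.IsHomogeneous (e + 2))
    (hsing : (singularSet f).Finite) (hg : ∀ p ∈ singularSet f, IsLocalEquation f p (g p))
    {I : Ideal (MvPolynomial (Fin (n + 1)) ℂ)} {c : Fin (n + 1) → ℂ}
    (hℓ : ∀ b, linearForm c * b ∈ I → b ∈ I) {h : MvPolynomial (Fin (n + 1)) ℂ}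
    (hh : ∀ j, h * pderiv j f ∈ I) {H : MvPolynomial (Fin (n + 1)) ℂ}
    (hH : H ∈ ∏ p ∈ hsing.toFinset, lineIdeal p.rep ^ aInv (g p)) : H * h ∈ I := by
  have hJ : ∀ q ∈ Ideal.span (Set.range fun j => pderiv j f), q * h ∈ I := by
    intro q hq
    obtain ⟨a, rfl⟩ := exists_dotProduct_of_mem_span hq
    rw [dotProduct, Finset.sum_mul]
    refine Ideal.sum_mem _ fun j _ => ?_
    rw [mul_assoc, mul_comm (pderiv j f)]
    exact Ideal.mul_mem_left _ _ (hh j)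
  -- The colon ideal (I : H h) has no zero besides the origin: off the singular set a partial
  -- derivative in it is nonzero, and at a singular point the local multiplier S is. So it contains
  -- a power of the linear form c, which cancels modulo I.
  let 𝔠 : Ideal (MvPolynomial (Fin (n + 1)) ℂ) :=
    Submodule.comap (LinearMap.toSpanSingleton _ _ (H * h)) I
  have h𝔠 : ∀ q, q ∈ 𝔠 ↔ q * (H * h) ∈ I := fun q => Iff.rfl
  have hrad : idealOfVars (Fin (n + 1)) ℂ ≤ 𝔠.radical := by
    refine idealOfVars_le_radical fun x hx => ?_
    by_cases hxJ : ∃ j, eval x (pderiv j f) ≠ 0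
    · obtain ⟨j, hj⟩ := hxJ
      refine ⟨_, (h𝔠 _).mpr ?_, hj⟩
      rw [mul_left_comm]
      exact I.mul_mem_left _ (hJ _ (Ideal.subset_span ⟨j, rfl⟩))
    · push Not at hxJ
      have hmem := mk_mem_singularSet (by omega) hf hx hxJ
      have hH' : H ∈ lineIdeal x ^ aInv (g (Projectivization.mk ℂ x hx)) := by
        obtain ⟨a, ha⟩ := Projectivization.exists_smul_eq_mk_rep ℂ x hx
        have := Ideal.prod_le_inf.trans (Finset.inf_le
          (f := fun p : ℙ ℂ (Fin (n + 1) → ℂ) => lineIdeal p.rep ^ aInv (g p))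
          (hsing.mem_toFinset.mpr hmem)) hH
        rwa [← ha, Units.smul_def, lineIdeal_smul a.ne_zero] at this
      obtain ⟨S, hS, hSH⟩ := exists_mul_mem_of_isLocalEquation (by omega) hf
        (Z := hsing.toFinset) (fun y hy hyJ => hsing.mem_toFinset.mpr
          (mk_mem_singularSet (by omega) hf hy fun j => hyJ _ (Ideal.subset_span ⟨j, rfl⟩)))
        hx (hg _ hmem) hH'
      refine ⟨S, (h𝔠 _).mpr ?_, hS⟩
      rw [← mul_assoc]
      exact hJ _ hSH
  obtain ⟨k, hk⟩ := hrad ((isHomogeneous_linearForm c).mem_idealOfVars one_ne_zero)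
  exact mem_of_pow_mul_mem hℓ ((h𝔠 _).mp hk)

/-- The vanishing of `(I : J) / I` in low degrees, for the ideal `I` generated by `n` general
combinations of the partial derivatives of `f`. -/
theorem mem_span_of_mul_pderiv_mem (hf : f.IsHomogeneous (e + 2))
    (hsing : (singularSet f).Finite) (hg : ∀ p ∈ singularSet f, IsLocalEquation f p (g p))
    {G : Fin n → MvPolynomial (Fin (n + 1)) ℂ} (hG : ∀ j, (G j).IsHomogeneous (e + 1))
    (hGJ : ∀ j, G j ∈ Ideal.span (Set.range fun j => pderiv j f)) {c : Fin (n + 1) → ℂ}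
    (hc : c ≠ 0)
    (hrad : ∀ i, X i ∈ (Ideal.span (Set.range G) ⊔ Ideal.span {linearForm c}).radical) :
    ∀ (m : ℕ) (h : MvPolynomial (Fin (n + 1)) ℂ), h.IsHomogeneous m →
      (∀ j, h * pderiv j f ∈ Ideal.span (Set.range G)) →
      m + ∑ p ∈ hsing.toFinset, aInv (g p) ≤ n * e → h ∈ Ideal.span (Set.range G) := by
  obtain ⟨-, hℓ, hsoc⟩ := (hasKoszulSyzygiesAndSocle e n).of_linearForm hG hc hrad
  -- The G j lie in J and so vanish at singular points; c cannot vanish there too, as the common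
  -- zero would have to be the origin.
  have hcp : ∀ p ∈ hsing.toFinset, c ⬝ᵥ p.rep ≠ 0 := by
    intro p hp h0
    have hp' := hsing.mem_toFinset.mp hp
    have hle : Ideal.span (Set.range G) ⊔ Ideal.span {linearForm c} ≤
        RingHom.ker (eval p.rep) := by
      refine sup_le ?_ ?_
      · rw [Ideal.span_le]
        rintro _ ⟨j, rfl⟩
        have hJ : Ideal.span (Set.range fun j => pderiv j f) ≤ RingHom.ker (eval p.rep) := by
          rw [Ideal.span_le]
          rintro _ ⟨j, rfl⟩
          exact hp'.2 j
        exact hJ (hGJ j)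
      · rw [Ideal.span_singleton_le_iff_mem, RingHom.mem_ker, eval_linearForm, h0]
    apply p.rep_nonzero
    ext i
    have := ((RingHom.ker_isPrime (eval p.rep)).radical_le_iff.mpr hle) (hrad i)
    simpa using this
  set I := Ideal.span (Set.range G) with hI
  have hIhom := isHomogeneous_span_range hG
  intro m
  induction m using Nat.strong_induction_on with
  | _ m ih =>
  intro h hh hhJ hm
  have h1 : h ∈ I ⊔ Ideal.span {linearForm c} := by
    -- The number of socle steps is Σ a(g_p): modulo ℓ, each monomial of that degree is a polynomial
    -- with the required vanishing at all singular points.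
    refine mem_of_forall_pow_idealOfVars_mul_mem hsoc _ m h hh hm fun u hu => ?_
    obtain ⟨H, hH, z, hz, rfl⟩ := Submodule.mem_sup.mp
      (idealOfVars_pow_le_prod_sup hsing.toFinset (fun p => p.rep) (fun p => aInv (g p)) hcp hu)
    rw [add_mul]
    exact Submodule.add_mem_sup (mul_mem_of_mem_prod_lineIdeal hf hsing hg hℓ hhJ hH)
      (Ideal.mul_mem_right _ _ hz)
  obtain ⟨y, hy, z, hz, hyz⟩ := Submodule.mem_sup.mp h1
  obtain ⟨w, rfl⟩ := Ideal.mem_span_singleton'.mp hz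
  have hcomp := congrArg (homogeneousComponent m) hyz
  have hy' : homogeneousComponent m y ∈ I := homogeneousComponent_mem_of_mem hIhom hy _
  rw [map_add, homogeneousComponent_mul_of_isHomogeneous (isHomogeneous_linearForm c),
    homogeneousComponent_eq_self hh] at hcomp
  by_cases hm1 : 1 ≤ m
  · rw [if_pos hm1] at hcomp
    -- Since ℓ w differs from h by an element of I and ℓ cancels modulo I, w also multiplies J into
    -- I.
    have hw : homogeneousComponent (m - 1) w ∈ I := by
      refine ih (m - 1) (by omega) _ (homogeneousComponent_isHomogeneous _ _) (fun j => hℓ _ ?_)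
        (by omega)
      have : linearForm c * (homogeneousComponent (m - 1) w * pderiv j f) =
          h * pderiv j f - homogeneousComponent m y * pderiv j f := by
        rw [← hcomp]; ring
      rw [this]
      exact I.sub_mem (hhJ j) (I.mul_mem_right _ hy')
    rw [← hcomp]
    exact I.add_mem hy' (I.mul_mem_right _ hw)
  · rw [if_neg hm1, add_zero] at hcomp
    rwa [← hcomp]

/-- Homogeneous Jacobian syzygies of low degree are Koszul. -/
theorem isKoszul_of_syzygy (hf : f.IsHomogeneous (e + 2))
    (hsing : (singularSet f).Finite) (hg : ∀ p ∈ singularSet f, IsLocalEquation f p (g p)) {m : ℕ}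
    (hm : m + ∑ p ∈ hsing.toFinset, aInv (g p) ≤ n * e)
    {a : Fin (n + 1) → MvPolynomial (Fin (n + 1)) ℂ} (ha : ∀ j, (a j).IsHomogeneous m)
    (haf : a ⬝ᵥ (fun j => pderiv j f) = 0) : IsKoszul (fun j => pderiv j f) a := by
  set F : Fin (n + 1) → MvPolynomial (Fin (n + 1)) ℂ := fun j => pderiv j f with hF
  have hFhom : ∀ j, (F j).IsHomogeneous (e + 1) := fun j => hf.pderiv
  have hdim : ProjDimLEZero (Ideal.span (Set.range F)) :=
    projDimLEZero_of_finite (Z := hsing.toFinset) fun x hx hxJ => hsing.mem_toFinset.mpr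
      (mk_mem_singularSet (by omega) hf hx fun j => hxJ _ (Ideal.subset_span ⟨j, rfl⟩))
  obtain ⟨A, hA, hAdim⟩ := exists_generic_linearCombinations hFhom hdim
  have hAdet := (Matrix.isUnit_iff_isUnit_det A).mp hA
  set A' : Matrix (Fin (n + 1)) (Fin (n + 1)) (MvPolynomial (Fin (n + 1)) ℂ) := A.map C with hA'
  set B' : Matrix (Fin (n + 1)) (Fin (n + 1)) (MvPolynomial (Fin (n + 1)) ℂ) := A⁻¹.map C
    with hB'
  have hBA : B' * A' = 1 := by
    rw [hA', hB', ← Matrix.map_mul, Matrix.nonsing_inv_mul A hAdet]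
    exact Matrix.map_one C C_0 C_1
  set G := A'.mulVec F with hG
  have hGhom : ∀ j, (G j).IsHomogeneous (e + 1) := fun j =>
    IsHomogeneous.sum _ _ _ fun k _ => (hFhom k).C_mul _
  have hGhom' : ∀ j : Fin n, (Fin.tail G j).IsHomogeneous (e + 1) := fun j => hGhom j.succ
  obtain ⟨c, hc, hrad⟩ := exists_linearForm_of_projDimLEZero (isHomogeneous_span_range hGhom') hAdim
  obtain ⟨hK, -, -⟩ := (hasKoszulSyzygiesAndSocle e n).of_linearForm hGhom' hc hrad
  set b := Matrix.vecMul a B' with hb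
  have hbA : Matrix.vecMul b A' = a := by
    rw [hb, Matrix.vecMul_vecMul, hBA, Matrix.vecMul_one]
  have hbG : b ⬝ᵥ G = 0 := by
    rw [hG, Matrix.dotProduct_mulVec, hbA, haf]
  have hbG' : b 0 * G 0 + Fin.tail b ⬝ᵥ Fin.tail G = 0 := by
    rw [← hbG, dotProduct, dotProduct, Fin.sum_univ_succ]
    rfl
  have hbhom : (b 0).IsHomogeneous m := IsHomogeneous.sum _ _ _ fun k _ => by
    simp only [hB', Matrix.map_apply]
    rw [mul_comm]
    exact (ha k).C_mul _
  -- For j = 0 the syzygy itself expresses b 0 * G 0 through the other G j. As A is invertible, b 0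
  -- then multiplies all of J into the ideal.
  have hbGj : ∀ j, b 0 * G j ∈ Ideal.span (Set.range (Fin.tail G)) := by
    intro j
    refine Fin.cases ?_ (fun j => ?_) j
    · rw [eq_neg_of_add_eq_zero_left hbG']
      exact neg_mem (dotProduct_mem_span _ _)
    · exact Ideal.mul_mem_left _ _ (Ideal.subset_span ⟨j, rfl⟩)
  have hb0 : b 0 ∈ Ideal.span (Set.range (Fin.tail G)) := by
    refine mem_span_of_mul_pderiv_mem hf hsing hg hGhom' (fun j => dotProduct_mem_span _ F) hc hrad
      m (b 0) hbhom (fun j => ?_) hm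
    have hFG : F = B'.mulVec G := by
      rw [hG, Matrix.mulVec_mulVec, hBA, Matrix.one_mulVec]
    change b 0 * F j ∈ _
    rw [hFG, Matrix.mulVec, dotProduct, Finset.mul_sum]
    refine Ideal.sum_mem _ fun k _ => ?_
    rw [mul_left_comm]
    exact Ideal.mul_mem_left _ _ (hbGj k)
  have hkos := hK.isKoszul_cons hbG' hb0
  rw [Fin.cons_self_tail, Fin.cons_self_tail] at hkos
  rw [← hbA]
  exact hkos.vecMul_of_mulVec

end

end Hypersurface

theorem theorem2p4 {n N : ℕ} (hN : 1 < N) (f : MvPolynomial (Fin (n + 1)) ℂ) (hf0 : f ≠ 0)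
    (hf : f.IsHomogeneous N)
    (hsing : (Hypersurface.singularSet f).Finite)
    (g : ℙ ℂ (Fin (n + 1) → ℂ) → HolGerm n)
    (hg : ∀ p ∈ Hypersurface.singularSet f, Hypersurface.IsLocalEquation f p (g p))
    (m : ℕ)
    (hm : (m : ℤ) ≤ (n : ℤ) * ((N : ℤ) - 2) - ∑ p ∈ hsing.toFinset, (HolGerm.aInv (g p) : ℤ)) :
    Hypersurface.ERdeg f m = ⊥ := by
  obtain ⟨e, rfl⟩ : ∃ e, N = e + 2 := ⟨N - 2, by omega⟩
  have hm' : m + ∑ p ∈ hsing.toFinset, HolGerm.aInv (g p) ≤ n * e := by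
    zify
    push_cast at hm
    linarith
  rw [eq_bot_iff]
  rintro _ ⟨⟨a, haAR⟩, ha, rfl⟩
  rw [Submodule.mem_bot]
  refine (Submodule.Quotient.mk_eq_zero _).mpr ?_
  change a ∈ Hypersurface.KR f
  refine Hypersurface.mem_KR_of_isKoszul
    (Hypersurface.isKoszul_of_syzygy hf hsing hg hm' (fun j => ?_) ?_)
  · exact ha j (Set.mem_univ j)
  · simpa [Hypersurface.AR, Fintype.linearCombination_apply, dotProduct] using haAR
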